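/- Let $\alpha\ge 2$, $\ell\ge 1$, $\varepsilon\ge 0$, $h$ and $r\ge 1$ be integers with $\ell+\varepsilon<h\le \alpha\ell+\varepsilon$. The generalized combination network $\mathcal N=(\varepsilon,\ell)\text{-}\mathcal N_{h,r,\alpha\ell+\varepsilon}$ has a source holding $h$ messages, joined by $\ell$ parallel links to each of $r$ middle nodes; each set of $\alpha$ middle nodes has its own receiver, joined by $\ell$ parallel links to each node of the set and by $\varepsilon$ direct links to the source. Each receiver demands all $h$ messages. A $(q,t)$-linear solution ($q$ a prime power, $t\ge1$) is a linear network code whose messages and packets are vectors in $\mathbb F_q^t$ and whose coding coefficients are $t\times t$ matrices over $\mathbb F_q$, such that every receiver can recover all messages. Put $$q_s(\mathcal N)=\min\{q : \mathcal N\text{ has a }(q,1)\text{-linear solution}\},\qquad q_v(\mathcal N)=\min\{q^t : \mathcal N\text{ has a }(q,t)\text{-linear solution}\},$$ $$\mathrm{gap}(\mathcal N)=\log_2 q_s(\mathcal N)-\log_2 q_v(\mathcal N).$$ Let $\gamma=3.48$, $\theta=\alpha-\lfloor (h-\varepsilon)/\ell\rfloor+1$, $\beta=\left(\frac{(\alpha-1)!}{2e\gamma\alpha}\right)^{1/(\alpha-1)}$,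 $$f(t)=(\alpha\ell+\varepsilon-h)\varepsilon t^2+(\alpha\ell+2\varepsilon-h)t+1,$$ $$g(t)=\max\{\ell t,(h-\ell)t\}\cdot\bigl(\min\{\ell t,(h-\ell)t\}-(h-\ell-\varepsilon)t+1\bigr),$$ let $t_\Delta$ be the smallest positive integer $t$ with $2^{f(t)/(\alpha-1)}\ge r/\beta$, and let $t_\star$ be the smallest positive integer $t$ with $2^{g(t)}\ge r/(\alpha-1)$. (a) Both minima defining the gap exist. (b) Let $h\ge 2\ell+\varepsilon$. If $\varepsilon\neq0$ or $h\ne\alpha\ell$, then $t_\Delta$ exists. Whenever $t_\Delta$ exists and $r+\theta-\alpha>0$, $$\mathrm{gap}(\mathcal N)\ge \frac{1}{\ell(\varepsilon+1)}\log_2\!\left(\frac{r+\theta-\alpha}{\gamma\theta}\right)-t_\Delta .$$ (c) Let $h<2\ell+\varepsilon$. Then $t_\star$ exists and $$\mathrm{gap}(\mathcal N)\ge \frac{1}{\ell(\varepsilon+1)}\log_2\!\left(\frac{r}{\gamma(\alpha-1)}\right)-t_\star .$$ (d) Assume in addition $\varepsilon\ge1$ and $h<\alpha\ell+\varepsilon$.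 If $h\ge 2\ell+\varepsilon$, $r+\theta-\alpha>0$ and $r\ge\beta$, then $$\mathrm{gap}(\mathcal N)\ge \frac{\log_2\left(\frac{r+\theta-\alpha}{\gamma\theta}\right)}{\ell(\varepsilon+1)}-\left\lceil\sqrt{\frac{(\alpha-1)\log_2(r/\beta)}{(\alpha\ell+\varepsilon-h)\varepsilon}}\,\right\rceil .$$ If $h<2\ell+\varepsilon$ and $r\ge\alpha-1$, then $$\mathrm{gap}(\mathcal N)\ge \frac{\log_2\left(\frac{r}{\alpha-1}\right)-2}{\ell(\varepsilon+1)}-\left\lceil\sqrt{\frac{\log_2\left(\frac{r}{\alpha-1}\right)}{\lambda}}\,\right\rceil,$$ where $\lambda$ is the coefficient of $t^2$ in $g(t)$, that is, $\lambda=\ell\varepsilon$ if $h\le2\ell$ and $\lambda=(h-\ell)(2\ell+\varepsilon-h)$ if $h>2\ell$. (e) If $\varepsilon\ge1$ and $h<\alpha\ell+\varepsilon$, and all parameters except $r$ are fixed, then $\mathrm{gap}(\mathcal N)=\Omega(\log r)$, and moreover $\mathrm{gap}(\mathcal N)=\Theta(\log r)$, as $r\to\infty$. -/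

import Mathlib

/-!
The generalized combination network with parameters `(ε, ℓ)`, `h`, `r`, `α`:

* the source holds `h` messages and is joined to each of `r` middle nodes by `ℓ` parallel links;
* every `α`-subset `S` of the middle nodes has its own receiver, joined to each node of `S` by
  `ℓ` parallel links and to the source by `ε` direct links.

In a `(q, t)`-linear code, messages and packets on links are vectors in `F ^ t`, where `F` is the
field with `q` elements, so that the `h` messages together form a vector in `F ^ (h * t)`.
-/

namespace GenCombNet

/-- A linear network code of vector length `t` over `F`. -/
structure LinearCode (F : Type) (α ℓ ε h r t : ℕ) where
  /-- coding coefficients for the `ℓ` links from the source to each middle node -/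
  A : Fin r → Matrix (Fin (ℓ * t)) (Fin (h * t)) F
  /-- coding coefficients used by middle node `i` on its `ℓ` links to receiver `S`
  (the identity matrix if the node just forwards its packets) -/
  D : {S : Finset (Fin r) // S.card = α} → Fin r → Matrix (Fin (ℓ * t)) (Fin (ℓ * t)) F
  /-- coding coefficients for the `ε` direct links from the source to receiver `S` -/
  B : {S : Finset (Fin r) // S.card = α} → Matrix (Fin (ε * t)) (Fin (h * t)) F

/-- All that receiver `S` gets when the source messages are `x`: the packets from the `α` middle
nodes in `S`, and the packets on its direct links. -/
def LinearCode.received {F : Type} [Field F] {α ℓ ε h r t : ℕ} (C : LinearCode F α ℓ ε h r t)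
    (S : {S : Finset (Fin r) // S.card = α}) (x : Fin (h * t) → F) :
    ({i : Fin r // i ∈ S.1} → Fin (ℓ * t) → F) × (Fin (ε * t) → F) :=
  (fun i => (C.D S i.1).mulVec ((C.A i.1).mulVec x), (C.B S).mulVec x)

/-- The code is a solution if every receiver can recover all the source messages. -/
def LinearCode.IsSolution {F : Type} [Field F] {α ℓ ε h r t : ℕ}
    (C : LinearCode F α ℓ ε h r t) : Prop :=
  ∀ S, Function.Injective (C.received S)

/-- The network has a `(q, t)`-linear solution. -/
def HasLinearSolution (α ℓ ε h r q t : ℕ) : Prop :=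
  ∃ (F : Type) (_ : Field F) (_ : Finite F),
    Nat.card F = q ∧ ∃ C : LinearCode F α ℓ ε h r t, C.IsSolution

/-- The alphabet sizes `q` of scalar linear solutions. -/
def scalarSizes (α ℓ ε h r : ℕ) : Set ℕ :=
  {q | HasLinearSolution α ℓ ε h r q 1}

/-- The alphabet sizes `q ^ t` of vector linear solutions. -/
def vectorSizes (α ℓ ε h r : ℕ) : Set ℕ :=
  {n | ∃ q t : ℕ, 1 ≤ t ∧ n = q ^ t ∧ HasLinearSolution α ℓ ε h r q t}

/-- The size of a scalar-optimal solution. -/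
noncomputable def qs (α ℓ ε h r : ℕ) : ℕ := sInf (scalarSizes α ℓ ε h r)

/-- The size of a vector-optimal solution. -/
noncomputable def qv (α ℓ ε h r : ℕ) : ℕ := sInf (vectorSizes α ℓ ε h r)

/-- The gap between scalar and vector linear solutions, in bits per symbol. -/
noncomputable def gap (α ℓ ε h r : ℕ) : ℝ :=
  Real.logb 2 (qs α ℓ ε h r) - Real.logb 2 (qv α ℓ ε h r)

/-- The constant in the bound `< γ * q ^ (k * (n - k))` for Gaussian binomial coefficients. -/
noncomputable def gam : ℝ := 3.48

/-- `θ = α - ⌊(h - ε) / ℓ⌋ + 1`. -/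
noncomputable def theta (α ℓ ε h : ℕ) : ℝ :=
  (α : ℝ) - (⌊((h : ℝ) - ε) / ℓ⌋ : ℝ) + 1

/-- `β = ((α - 1)! / (2 e γ α)) ^ (1 / (α - 1))`. -/
noncomputable def beta (α : ℕ) : ℝ :=
  ((Nat.factorial (α - 1) : ℝ) / (2 * Real.exp 1 * gam * α)) ^ (1 / ((α : ℝ) - 1))

/-- `f(t) = (αℓ + ε - h) ε t² + (αℓ + 2ε - h) t + 1`. -/
noncomputable def f (α ℓ ε h : ℕ) (t : ℕ) : ℝ :=
  ((α : ℝ) * ℓ + ε - h) * ε * (t : ℝ) ^ 2 + ((α : ℝ) * ℓ + 2 * ε - h) * t + 1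

/-- `g(t) = max {ℓt, (h-ℓ)t} · (min {ℓt, (h-ℓ)t} - (h-ℓ-ε)t + 1)`. -/
noncomputable def g (ℓ ε h : ℕ) (t : ℕ) : ℝ :=
  max ((ℓ : ℝ) * t) (((h : ℝ) - ℓ) * t) *
    (min ((ℓ : ℝ) * t) (((h : ℝ) - ℓ) * t) - ((h : ℝ) - ℓ - ε) * t + 1)

/-- The coefficient of `t²` in `g(t)`; it is `ℓ ε` if `h ≤ 2ℓ`, and `(h-ℓ)(2ℓ+ε-h)` otherwise. -/
noncomputable def gLead (ℓ ε h : ℕ) : ℝ :=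
  if h ≤ 2 * ℓ then (ℓ : ℝ) * ε else ((h : ℝ) - ℓ) * (2 * ℓ + ε - h)

/-- `t` is the smallest positive integer with `2 ^ (f(t) / (α - 1)) ≥ r / β`. -/
def IsTDelta (α ℓ ε h r t : ℕ) : Prop :=
  IsLeast {t : ℕ | 1 ≤ t ∧ (r : ℝ) / beta α ≤ (2 : ℝ) ^ (f α ℓ ε h t / ((α : ℝ) - 1))} t

/-- `t` is the smallest positive integer with `2 ^ g(t) ≥ r / (α - 1)`. -/
def IsTStar (α ℓ ε h r t : ℕ) : Prop :=
  IsLeast {t : ℕ | 1 ≤ t ∧ (r : ℝ) / ((α : ℝ) - 1) ≤ (2 : ℝ) ^ g ℓ ε h t} t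

end GenCombNet

/-!
Coding coefficients from the source to the middle nodes extend to a solution if and only if, for
every receiver, the messages that its `α` middle nodes jointly fail to see form a space of dimension at most `ε t`,
because the `ε` direct links can be coded to separate a space of that dimension and no larger one.
Everything is stated in terms of the kernels of the maps `φ i` that send the messages to the packets
of middle node `i`.

The lower bound for scalar codes (`scalar_bound`) is a double count. The kernels of `m - 1` middle
nodes, with `m = ⌊(h - ε - 1) / ℓ⌋`, share a space `P` of dimension `ℓ + ε + 1`. Each remaining
kernel meets `P` in dimension at least `ε + 1`, and the intersections of `α - m + 1` of them with
`P` have no common subspace of that dimension. Counting linearly independent `(ε + 1)`-tuples in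
`P` gives `r - (m - 1) ≤ (α - m) γ q ^ (ℓ (ε + 1))`; the constant `γ` bounds the ratio of all
square matrices to the invertible ones.

The upper bound for vector codes uses the field with two elements. For `h ≥ 2ℓ + ε` the maps
`φ i` are random: an `α`-subset is bad with probability at most `γ 2 ^ (-f(t))`, and
`exists_forall_not_bad`, a form of the local lemma proved by counting, avoids all bad subsets.
For `h < 2ℓ + ε` the maps are `[I | c]` with `c` in a Gabidulin code of `2 ^ g(t)` elements, each
used at most `α - 1` times, so that two different ones occur among any `α`; their kernels meet in a
space isomorphic to the kernel of the difference.

The explicit bounds follow on choosing `t` so large that the quadratic term of `f` or `g` suffices;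
if the resulting `t` is `0`, their left-hand side is not positive, and the gap is never negative.
Random scalar coefficients
over a prime field of size of the order `r ^ (α - 1)` show that scalar solutions exist and that
the gap is `O(log r)`.
-/

namespace GenCombNet

/-! ### Counting frames -/

section Frames

variable {F : Type*} [Field F] [Finite F] {V W : Type*} [AddCommGroup V] [Module F V] [Finite V]
  [AddCommGroup W] [Module F W] [Finite W]

/-- The number of ordered bases of an `n`-dimensional vector space over a field with `q`
elements. -/
def numFrames (q n : ℕ) : ℕ := ∏ i : Fin n, (q ^ n - q ^ i.val)

/-- The first eight factors are kept, and the product of the others is at least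
`1 - ∑_{8 < i ≤ n} 2 ^ (-i)`. -/
lemma prod_one_sub_two_pow_ge (n : ℕ) :
    (1 : ℝ) / 3.48 ≤ ∏ i ∈ Finset.range n, (1 - (1 / 2 : ℝ) ^ (i + 1)) := by
  have key : ∀ m : ℕ, (∏ i ∈ Finset.range 8, (1 - (1 / 2 : ℝ) ^ (i + 1))) *
      (1 - (1 / 2 : ℝ) ^ 8 + (1 / 2 : ℝ) ^ (8 + m)) ≤
      ∏ i ∈ Finset.range (8 + m), (1 - (1 / 2 : ℝ) ^ (i + 1)) := by
    intro m
    induction m with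
    | zero => norm_num [Finset.prod_range_succ]
    | succ m ih =>
      rw [← Nat.add_assoc, Finset.prod_range_succ _ (8 + m)]
      have h1 : (0 : ℝ) ≤ 1 - (1 / 2 : ℝ) ^ (8 + m + 1) :=
        sub_nonneg.2 (pow_le_one₀ (by norm_num) (by norm_num))
      refine le_trans ?_ (mul_le_mul_of_nonneg_right ih h1)
      have h2 : (0 : ℝ) ≤ ∏ i ∈ Finset.range 8, (1 - (1 / 2 : ℝ) ^ (i + 1)) :=
        Finset.prod_nonneg fun i _ => sub_nonneg.2 (pow_le_one₀ (by norm_num) (by norm_num))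
      rw [mul_assoc]
      refine mul_le_mul_of_nonneg_left ?_ h2
      have h3 : (1 / 2 : ℝ) ^ (8 + m) ≤ (1 / 2 : ℝ) ^ 8 :=
        pow_le_pow_of_le_one (by norm_num) (by norm_num) (by omega)
      have h4 : (0 : ℝ) ≤ (1 / 2 : ℝ) ^ (8 + m) := by positivity
      rw [pow_succ _ (8 + m)]
      nlinarith [mul_nonneg h4 (sub_nonneg.2 h3)]
  have anti : Antitone fun n : ℕ => ∏ i ∈ Finset.range n, (1 - (1 / 2 : ℝ) ^ (i + 1)) := by
    refine antitone_nat_of_succ_le fun n => ?_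
    rw [Finset.prod_range_succ]
    refine mul_le_of_le_one_right (Finset.prod_nonneg fun i _ =>
      sub_nonneg.2 (pow_le_one₀ (by norm_num) (by norm_num))) ?_
    have : (0 : ℝ) ≤ (1 / 2 : ℝ) ^ (n + 1) := by positivity
    linarith
  refine le_trans ?_ (anti (show n ≤ 8 + n by omega))
  refine le_trans ?_ (key n)
  have h4 : (0 : ℝ) ≤ (1 / 2 : ℝ) ^ (8 + n) := by positivity
  have h5 : (1 : ℝ) / 3.48 ≤ (∏ i ∈ Finset.range 8, (1 - (1 / 2 : ℝ) ^ (i + 1))) *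
      (1 - (1 / 2 : ℝ) ^ 8) := by
    norm_num [Finset.prod_range_succ]
  refine h5.trans (mul_le_mul_of_nonneg_left (by linarith) ?_)
  exact Finset.prod_nonneg fun i _ => sub_nonneg.2 (pow_le_one₀ (by norm_num) (by norm_num))

/-- The fraction of the `n × n` matrices that are invertible is at least `1 / γ`. -/
lemma pow_le_gam_mul_numFrames {q : ℕ} (hq : 2 ≤ q) (n : ℕ) :
    (q : ℝ) ^ (n * n) ≤ gam * numFrames q n := by
  have hq0 : (0 : ℝ) < q := by positivity
  have hq2 : (2 : ℝ) ≤ q := by exact_mod_cast hq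
  have h1 : (numFrames q n : ℝ) =
      (q : ℝ) ^ (n * n) * ∏ i ∈ Finset.range n, (1 - (1 / q : ℝ) ^ (i + 1)) := by
    rw [numFrames, Nat.cast_prod, Finset.prod_range, ← Equiv.prod_comp Fin.revPerm, pow_mul]
    have h0 : ((q : ℝ) ^ n) ^ n = ∏ _i : Fin n, (q : ℝ) ^ n := by simp
    rw [h0, ← Finset.prod_mul_distrib]
    refine Finset.prod_congr rfl fun i _ => ?_
    have hi : (Fin.revPerm i).val = n - (i.val + 1) := by simp [Fin.val_rev]
    rw [hi, Nat.cast_sub (Nat.pow_le_pow_right (by omega) (by omega))]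
    push_cast
    rw [mul_sub, mul_one, div_pow, one_pow, mul_one_div, pow_sub₀ _ hq0.ne' (by omega)]
    rfl
  have h2 : (1 : ℝ) / 3.48 ≤ ∏ i ∈ Finset.range n, (1 - (1 / q : ℝ) ^ (i + 1)) := by
    refine (prod_one_sub_two_pow_ge n).trans (Finset.prod_le_prod (fun i _ =>
      sub_nonneg.2 (pow_le_one₀ (by norm_num) (by norm_num))) fun i _ => ?_)
    have : (1 / q : ℝ) ^ (i + 1) ≤ (1 / 2 : ℝ) ^ (i + 1) := by gcongr
    linarith
  rw [h1, gam]
  have h3 : (0 : ℝ) < (q : ℝ) ^ (n * n) := by positivity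
  have h4 : 1 ≤ 3.48 * ∏ i ∈ Finset.range n, (1 - (1 / q : ℝ) ^ (i + 1)) := by
    rw [div_le_iff₀ (by norm_num)] at h2
    linarith
  nlinarith

lemma numFrames_le_card (U : Submodule F V) {n : ℕ} (hn : n ≤ Module.finrank F U) :
    numFrames (Nat.card F) n ≤
      Nat.card {s : Fin n → V // LinearIndependent F s ∧ ∀ i, s i ∈ U} := by
  classical
  have := Fintype.ofFinite F
  have h1 : numFrames (Nat.card F) n ≤ Nat.card {s : Fin n → U // LinearIndependent F s} := by
    rw [card_linearIndependent hn, numFrames, Nat.card_eq_fintype_card]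
    refine Finset.prod_le_prod' fun i _ => Nat.sub_le_sub_right
      (Nat.pow_le_pow_right Fintype.card_pos hn) _
  refine h1.trans (Nat.card_le_card_of_injective
    (fun s => ⟨fun i => (s.1 i : V), s.2.map' U.subtype U.ker_subtype, fun i => (s.1 i).2⟩) ?_)
  intro s s' h
  ext i
  exact congrFun (congrArg Subtype.val h) i

lemma card_linearMap_vanishing {k : ℕ} {s : Fin k → V} (hs : LinearIndependent F s) :
    Nat.card {X : V →ₗ[F] W // ∀ i, X (s i) = 0} * Nat.card F ^ (Module.finrank F W * k) =
      Nat.card F ^ (Module.finrank F W * Module.finrank F V) := by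
  have : FiniteDimensional F V := Module.Finite.of_finite
  have : FiniteDimensional F W := Module.Finite.of_finite
  let j : (Fin k →₀ F) →ₗ[F] V := Finsupp.linearCombination F s
  have hj : LinearMap.ker j = ⊥ := linearIndependent_iff_ker.1 hs
  obtain ⟨p, hp⟩ := j.exists_leftInverse_of_injective hj
  let R : (V →ₗ[F] W) →ₗ[F] ((Fin k →₀ F) →ₗ[F] W) := LinearMap.lcomp F W j
  have hR : LinearMap.range R = ⊤ := by
    rw [LinearMap.range_eq_top]
    intro Y
    refine ⟨Y ∘ₗ p, ?_⟩
    change (Y ∘ₗ p) ∘ₗ j = Y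
    rw [LinearMap.comp_assoc, hp, LinearMap.comp_id]
  have hrn := R.finrank_range_add_finrank_ker
  rw [hR, finrank_top, Module.finrank_linearMap, Module.finrank_linearMap,
    Module.finrank_finsupp_self, Fintype.card_fin] at hrn
  have hker : Nat.card {X : V →ₗ[F] W // ∀ i, X (s i) = 0} = Nat.card (LinearMap.ker R) := by
    refine Nat.card_congr (Equiv.subtypeEquivRight fun X => ?_)
    rw [LinearMap.mem_ker]
    change _ ↔ X ∘ₗ j = 0
    constructor
    · intro h
      ext i
      simp [j, h i]
    · intro h i
      simpa [j] using LinearMap.congr_fun h (Finsupp.single i 1)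
  have : Finite (V →ₗ[F] W) := Module.finite_of_finite F
  rw [hker, Module.natCard_eq_pow_finrank (K := F) (V := LinearMap.ker R), ← pow_add]
  congr 1
  rw [mul_comm _ k, mul_comm _ (Module.finrank F V)]
  omega

/-- Linear maps whose kernel has dimension at least `k` are rare: double counting of the pairs of
such a map and `k` linearly independent vectors in its kernel. -/
lemma card_finrank_ker_ge_mul_le (k : ℕ) :
    Nat.card {X : V →ₗ[F] W // k ≤ Module.finrank F (LinearMap.ker X)} *
        numFrames (Nat.card F) k * Nat.card F ^ (Module.finrank F W * k) ≤
      Nat.card F ^ (Module.finrank F V * k + Module.finrank F W * Module.finrank F V) := by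
  classical
  have : FiniteDimensional F V := Module.Finite.of_finite
  have : FiniteDimensional F W := Module.Finite.of_finite
  have : Finite (V →ₗ[F] W) := Module.finite_of_finite F
  have := Fintype.ofFinite (V →ₗ[F] W)
  have := Fintype.ofFinite V
  set Q := Nat.card F
  set a := Module.finrank F W
  set b := Module.finrank F V
  have hQ : 0 < Q := Nat.card_pos
  let S : Finset (V →ₗ[F] W) := {X | k ≤ Module.finrank F (LinearMap.ker X)}
  let T : Finset (Fin k → V) := {s | LinearIndependent F s}
  have key : ∀ m : ℕ, m * Q ^ (a * k) = Q ^ (a * b) →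
      (∀ s ∈ T, (S.bipartiteBelow (fun X s => ∀ i, X (s i) = 0) s).card ≤ m) →
      S.card * numFrames Q k * Q ^ (a * k) ≤ Q ^ (b * k + a * b) := by
    intro m hm hT
    have h := Finset.card_mul_le_card_mul (s := S) (t := T) (m := numFrames Q k) (n := m)
      (fun X s => ∀ i, X (s i) = 0) ?_ hT
    · calc S.card * numFrames Q k * Q ^ (a * k) ≤ T.card * m * Q ^ (a * k) := by gcongr
        _ = T.card * Q ^ (a * b) := by rw [mul_assoc, hm]
        _ ≤ Q ^ (b * k) * Q ^ (a * b) := by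
          gcongr
          refine (Finset.card_le_univ T).trans ?_
          rw [← Nat.card_eq_fintype_card, Nat.card_fun, Module.natCard_eq_pow_finrank (K := F),
            Nat.card_fin, ← pow_mul]
        _ = _ := by rw [← pow_add]
    · intro X hX
      refine (numFrames_le_card (LinearMap.ker X) (Finset.mem_filter.1 hX).2).trans ?_
      rw [Nat.card_eq_fintype_card, Fintype.card_subtype, Finset.bipartiteAbove,
        Finset.filter_filter]
      exact le_of_eq (by simp)
  rw [Nat.card_eq_fintype_card (α := {X : V →ₗ[F] W // _}), Fintype.card_subtype]
  by_cases hk : k ≤ b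
  · refine key (Q ^ (a * (b - k))) ?_ fun s hs => ?_
    · rw [← pow_add, ← mul_add, Nat.sub_add_cancel hk]
    · have h := card_linearMap_vanishing (W := W) (Finset.mem_filter.1 hs).2
      have h2 : Q ^ (a * b) = Q ^ (a * (b - k)) * Q ^ (a * k) := by
        rw [← pow_add, ← mul_add, Nat.sub_add_cancel hk]
      change _ * Q ^ (a * k) = Q ^ (a * b) at h
      rw [h2] at h
      rw [← Nat.eq_of_mul_eq_mul_right (by positivity) h, Nat.card_eq_fintype_card,
        Fintype.card_subtype]
      exact Finset.card_le_card fun X hX => by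
        simpa using (Finset.mem_filter.1 hX).2
  · have : ({X | k ≤ Module.finrank F (LinearMap.ker X)} : Finset (V →ₗ[F] W)) = ∅ := by
      refine Finset.filter_eq_empty_iff.2 fun X _ h => hk (h.trans (Submodule.finrank_le _))
    rw [this]
    simp

/-- Subspaces of dimension at least `n`, no more than `c` of which share `n` linearly independent
vectors, are few: double counting of the pairs of a subspace and such vectors in it. -/
lemma card_mul_numFrames_le {ι : Type*} (I : Finset ι) (U : ι → Submodule F V) (n c : ℕ)
    (hU : ∀ i ∈ I, n ≤ Module.finrank F (U i))
    (hc : ∀ J ⊆ I, ∀ s : Fin n → V, LinearIndependent F s → (∀ i ∈ J, ∀ k, s k ∈ U i) →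
      J.card ≤ c) :
    I.card * numFrames (Nat.card F) n ≤ Nat.card F ^ (Module.finrank F V * n) * c := by
  classical
  have := Fintype.ofFinite V
  have : FiniteDimensional F V := Module.Finite.of_finite
  let T : Finset (Fin n → V) := {s | LinearIndependent F s}
  refine (Finset.card_mul_le_card_mul (s := I) (t := T) (n := c)
    (fun i s => ∀ k, s k ∈ U i) ?_ ?_).trans (Nat.mul_le_mul_right _ ?_)
  · intro i hi
    refine (numFrames_le_card (U i) (hU i hi)).trans ?_
    rw [Nat.card_eq_fintype_card, Fintype.card_subtype, Finset.bipartiteAbove,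
      Finset.filter_filter]
  · intro s hs
    exact hc _ (Finset.filter_subset _ _) s (Finset.mem_filter.1 hs).2
      fun i hi => (Finset.mem_filter.1 hi).2
  · refine (Finset.card_le_univ T).trans ?_
    rw [← Nat.card_eq_fintype_card, Nat.card_fun, Module.natCard_eq_pow_finrank (K := F),
      Nat.card_fin, ← pow_mul]

end Frames

/-! ### Solutions in terms of kernels -/

/-- The joint map of the packets that the source sends to the middle nodes in `S`. -/
def stack {F V W ι : Type*} [Field F] [AddCommGroup V] [Module F V] [AddCommGroup W] [Module F W]
    (φ : ι → V →ₗ[F] W) (S : Finset ι) : V →ₗ[F] ({i // i ∈ S} → W) :=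
  LinearMap.pi fun i => φ i

section Stack

variable {F V W ι : Type*} [Field F] [AddCommGroup V] [Module F V] [AddCommGroup W] [Module F W]

lemma mem_ker_stack {φ : ι → V →ₗ[F] W} {S : Finset ι} {x : V} :
    x ∈ LinearMap.ker (stack φ S) ↔ ∀ i ∈ S, φ i x = 0 := by
  simp [stack, funext_iff]

lemma finrank_le_finrank_ker_stack [FiniteDimensional F V] [FiniteDimensional F W]
    (φ : ι → V →ₗ[F] W) (S : Finset ι) :
    Module.finrank F V ≤ Module.finrank F (LinearMap.ker (stack φ S)) +
      S.card * Module.finrank F W := by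
  have h1 := (stack φ S).finrank_range_add_finrank_ker
  have h2 := Submodule.finrank_le (LinearMap.range (stack φ S))
  rw [Module.finrank_pi_fintype, Finset.sum_const, Finset.card_univ, Fintype.card_coe,
    smul_eq_mul] at h2
  omega

end Stack

/-- If the messages that any `α` middle nodes jointly fail to see form a space of dimension at
most `ε t`, then the direct links can be coded so that every receiver recovers all messages. -/
lemma hasLinearSolution_of_finrank_ker_stack_le {F : Type} [Field F] [Finite F]
    {α ℓ ε h r t : ℕ} (φ : Fin r → (Fin (h * t) → F) →ₗ[F] (Fin (ℓ * t) → F))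
    (hφ : ∀ S : Finset (Fin r), S.card = α →
      Module.finrank F (LinearMap.ker (stack φ S)) ≤ ε * t) :
    HasLinearSolution α ℓ ε h r (Nat.card F) t := by
  classical
  have hB : ∀ S : {S : Finset (Fin r) // S.card = α},
      ∃ B : (Fin (h * t) → F) →ₗ[F] (Fin (ε * t) → F),
        ∀ x ∈ LinearMap.ker (stack φ S.1), B x = 0 → x = 0 := by
    intro S
    obtain ⟨s, hs⟩ := exists_linearIndependent_of_le_finrank (R := F)
      (M := Fin (ε * t) → F) (n := Module.finrank F (LinearMap.ker (stack φ S.1)))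
      (by simpa using hφ S.1 S.2)
    let b := Module.finBasis F (LinearMap.ker (stack φ S.1))
    obtain ⟨B, hB⟩ := LinearMap.exists_extend (b.constr F s)
    refine ⟨B, fun x hx h0 => ?_⟩
    have hinj : Function.Injective (b.constr F s) := b.injective_constr_of_linearIndependent hs
    have h1 : b.constr F s ⟨x, hx⟩ = 0 := by
      rw [← hB]
      exact h0
    simpa using hinj (h1.trans (map_zero _).symm)
  choose B hB using hB
  refine ⟨F, inferInstance, inferInstance, rfl,
    ⟨fun i => LinearMap.toMatrix' (φ i), fun _ _ => 1, fun S => LinearMap.toMatrix' (B S)⟩, ?_⟩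
  intro S x y hxy
  simp only [LinearCode.received, Matrix.one_mulVec, LinearMap.toMatrix'_mulVec,
    Prod.mk.injEq, funext_iff, Subtype.forall] at hxy
  refine sub_eq_zero.1 (hB S (x - y) (mem_ker_stack.2 fun i hi => ?_) ?_)
  · rw [map_sub, sub_eq_zero]
    exact funext (hxy.1 i hi)
  · rw [map_sub, sub_eq_zero]
    exact funext hxy.2

/-- Conversely, in a solution the direct links separate the messages that the middle nodes of a
receiver jointly fail to see. -/
lemma LinearCode.IsSolution.finrank_ker_stack_le {F : Type} [Field F] {α ℓ ε h r t : ℕ}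
    {C : LinearCode F α ℓ ε h r t} (hC : C.IsSolution) (S : Finset (Fin r)) (hS : S.card = α) :
    Module.finrank F (LinearMap.ker (stack (fun i => (C.A i).mulVecLin) S)) ≤ ε * t := by
  have hinj : Function.Injective ((C.B ⟨S, hS⟩).mulVecLin ∘ₗ
      (LinearMap.ker (stack (fun i => (C.A i).mulVecLin) S)).subtype) := by
    rw [← LinearMap.ker_eq_bot, LinearMap.ker_eq_bot']
    intro x hx
    refine Subtype.ext (hC ⟨S, hS⟩ ?_)
    have h1 := mem_ker_stack.1 x.2
    simp only [LinearMap.coe_comp, Function.comp_apply, Submodule.coe_subtype,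
      Matrix.mulVecLin_apply] at hx h1
    refine Prod.ext (funext fun i => ?_) ?_
    · simp [received, -Matrix.mulVec_mulVec, h1 i.1 i.2]
    · simp [received, hx]
  simpa using LinearMap.finrank_le_finrank_of_injective hinj

/-! ### The lower bound for scalar solutions -/

/-- A scalar solution over the field with `q` elements forces `r` to be at most of the order
`q ^ (ℓ (ε + 1))`. The kernels of `m - 1` middle nodes share a space `P` of dimension
`ℓ + ε + 1`, in which each of the other kernels has dimension at least `ε + 1`. No `ε + 1`
linearly independent vectors lie in the kernels of `α` middle nodes, hence they lie in those of at
most `α - m` of the others. -/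
lemma scalar_bound {α ℓ ε h r q : ℕ} (hℓ : 1 ≤ ℓ) (hlow : ℓ + ε < h) (hup : h ≤ α * ℓ + ε)
    (hsol : HasLinearSolution α ℓ ε h r q 1) :
    (r : ℝ) + 1 ≤ ((h - ε - 1) / ℓ : ℕ) +
      ((α : ℝ) - ((h - ε - 1) / ℓ : ℕ)) * (gam * (q : ℝ) ^ (ℓ * (ε + 1))) := by
  classical
  obtain ⟨F, _, _, rfl, C, hC⟩ := hsol
  set m := (h - ε - 1) / ℓ with hm
  set q := Nat.card F
  have hq : 2 ≤ q := Finite.one_lt_card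
  have hm1 : 1 ≤ m := (Nat.le_div_iff_mul_le hℓ).2 (by omega)
  have hmα : m < α := (Nat.div_lt_iff_lt_mul hℓ).2 (by omega)
  have hmh : m * ℓ ≤ h - ε - 1 := Nat.div_mul_le_self _ _
  have hgq : 1 ≤ gam * (q : ℝ) ^ (ℓ * (ε + 1)) := by
    have : (1 : ℝ) ≤ (q : ℝ) ^ (ℓ * (ε + 1)) := one_le_pow₀ (by
      exact_mod_cast one_le_two.trans hq)
    rw [gam]
    linarith
  have hmα' : (m : ℝ) + 1 ≤ α := by exact_mod_cast hmα
  -- With fewer than `m` middle nodes the right-hand side is at least `m`.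
  by_cases hr : r < m
  · have : (r : ℝ) + 1 ≤ m := by exact_mod_cast hr
    nlinarith
  push Not at hr
  obtain ⟨J, -, hJ⟩ := Finset.exists_subset_card_eq (s := (Finset.univ : Finset (Fin r)))
    (n := m - 1) (by simp; omega)
  let φ : Fin r → (Fin (h * 1) → F) →ₗ[F] (Fin (ℓ * 1) → F) := fun i => (C.A i).mulVecLin
  have hK := finrank_le_finrank_ker_stack φ J
  simp only [Module.finrank_fintype_fun_eq_card, Fintype.card_fin, mul_one, hJ] at hK
  have hmul : (m - 1) * ℓ + ℓ = m * ℓ := by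
    rw [← Nat.succ_mul]
    congr 1
    omega
  obtain ⟨s, hs⟩ := exists_linearIndependent_of_le_finrank (R := F)
    (M := LinearMap.ker (stack φ J)) (n := ℓ + ε + 1) (by omega)
  let V := Fin (ℓ + ε + 1) → F
  have hV : Module.finrank F V = ℓ + ε + 1 := by simp [V]
  let ψ : V →ₗ[F] (Fin (h * 1) → F) :=
    (LinearMap.ker (stack φ J)).subtype ∘ₗ (Pi.basisFun F (Fin (ℓ + ε + 1))).constr F s
  have hψJ : ∀ v, ψ v ∈ LinearMap.ker (stack φ J) := fun v => Subtype.prop _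
  have hψ : LinearMap.ker ψ = ⊥ := by
    rw [LinearMap.ker_eq_bot]
    exact Subtype.val_injective.comp
      ((Pi.basisFun F (Fin (ℓ + ε + 1))).injective_constr_of_linearIndependent hs)
  have hcount := card_mul_numFrames_le (F := F) (V := V) Jᶜ (fun i => LinearMap.ker (φ i ∘ₗ ψ))
    (ε + 1) (α - m) ?_ ?_
  · rw [Finset.card_compl, Fintype.card_fin, hJ, hV] at hcount
    have h1 := pow_le_gam_mul_numFrames hq (ε + 1)
    have h2 : ((r - (m - 1) : ℕ) : ℝ) * numFrames q (ε + 1) ≤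
        (q : ℝ) ^ ((ℓ + ε + 1) * (ε + 1)) * ((α - m : ℕ) : ℝ) := by exact_mod_cast hcount
    rw [Nat.cast_sub (by omega), Nat.cast_sub hm1, Nat.cast_sub hmα.le, Nat.cast_one] at h2
    have h3 : (0 : ℝ) < (q : ℝ) ^ ((ε + 1) * (ε + 1)) := by positivity
    have h4 : (0 : ℝ) ≤ (r : ℝ) - (m - 1) := by
      have : (m : ℝ) ≤ r := by exact_mod_cast hr
      linarith
    have h5 : ((r : ℝ) - (m - 1)) * (q : ℝ) ^ ((ε + 1) * (ε + 1)) ≤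
        ((α : ℝ) - m) * (gam * (q : ℝ) ^ (ℓ * (ε + 1))) * (q : ℝ) ^ ((ε + 1) * (ε + 1)) :=
      calc ((r : ℝ) - (m - 1)) * (q : ℝ) ^ ((ε + 1) * (ε + 1))
          ≤ ((r : ℝ) - (m - 1)) * (gam * numFrames q (ε + 1)) := by gcongr
        _ = gam * (((r : ℝ) - (m - 1)) * numFrames q (ε + 1)) := by ring
        _ ≤ gam * ((q : ℝ) ^ ((ℓ + ε + 1) * (ε + 1)) * (α - m)) := by
          have : 0 ≤ gam := by norm_num [gam]
          gcongr
        _ = _ := by ring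
    have := le_of_mul_le_mul_right h5 h3
    linarith
  · intro i _
    have h1 := (φ i ∘ₗ ψ).finrank_range_add_finrank_ker
    have h2 := Submodule.finrank_le (LinearMap.range (φ i ∘ₗ ψ))
    simp only [Module.finrank_fintype_fun_eq_card, Fintype.card_fin, mul_one] at h2
    rw [hV] at h1
    omega
  · intro J' hJ' s' hs' hmem
    by_contra! hcard
    obtain ⟨I, hI, hIcard⟩ := Finset.exists_subset_card_eq (s := J') (n := α - m + 1) hcard
    have hdisj : Disjoint J I := by
      refine Finset.disjoint_left.2 fun i hiJ hiI => ?_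
      exact (Finset.mem_compl.1 (hJ' (hI hiI))) hiJ
    have hle := hC.finrank_ker_stack_le (J ∪ I) (by
      rw [Finset.card_union_of_disjoint hdisj]
      omega)
    have hker : ∀ k, ψ (s' k) ∈ LinearMap.ker (stack φ (J ∪ I)) := by
      intro k
      refine mem_ker_stack.2 fun i hi => ?_
      rcases Finset.mem_union.1 hi with hi | hi
      · exact mem_ker_stack.1 (hψJ (s' k)) i hi
      · exact hmem i (hI hi) k
    have hli : LinearIndependent F
        fun k => (⟨ψ (s' k), hker k⟩ : LinearMap.ker (stack φ (J ∪ I))) :=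
      LinearIndependent.of_comp (LinearMap.ker (stack φ (J ∪ I))).subtype (hs'.map' ψ hψ)
    have h1 := hli.fintype_card_le_finrank
    rw [Fintype.card_fin] at h1
    change Module.finrank F (LinearMap.ker (stack φ (J ∪ I))) ≤ _ at hle
    omega

/-! ### A counting form of the local lemma -/

section Counting

variable {ι Ω : Type*} [Fintype ι] [DecidableEq ι] [Fintype Ω]

/-- Events that depend on disjoint sets of coordinates are independent: exchanging the coordinates
in `S` matches the pairs on both sides. -/
lemma card_and_mul_card_eq (S : Finset ι) (P Q : (ι → Ω) → Prop) [DecidablePred P]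
    [DecidablePred Q] (hP : ∀ A B : ι → Ω, (∀ i ∈ S, A i = B i) → P A → P B)
    (hQ : ∀ A B : ι → Ω, (∀ i ∉ S, A i = B i) → Q A → Q B) :
    (Finset.univ.filter fun A : ι → Ω => P A ∧ Q A).card * Fintype.card (ι → Ω) =
      (Finset.univ.filter P).card * (Finset.univ.filter Q).card := by
  rw [← Finset.card_univ, ← Finset.card_product, ← Finset.card_product]
  refine Finset.card_nbij' (fun x => (S.piecewise x.1 x.2, S.piecewise x.2 x.1))
    (fun x => (S.piecewise x.1 x.2, S.piecewise x.2 x.1)) ?_ ?_ ?_ ?_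
  · rintro ⟨A, B⟩ h
    simp only [Finset.coe_product, Finset.coe_filter, Set.mem_prod, Set.mem_ofPred_eq,
      Finset.mem_univ, true_and, Finset.coe_univ, Set.mem_univ, and_true] at h ⊢
    exact ⟨hP A _ (fun i hi => by simp [hi]) h.1, hQ A _ (fun i hi => by simp [hi]) h.2⟩
  · rintro ⟨A, B⟩ h
    simp only [Finset.coe_product, Finset.coe_filter, Set.mem_prod, Set.mem_ofPred_eq,
      Finset.mem_univ, true_and, Finset.coe_univ, Set.mem_univ, and_true] at h ⊢
    exact ⟨hP A _ (fun i hi => by simp [hi]) h.1, hQ B _ (fun i hi => by simp [hi]) h.2⟩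
  · rintro ⟨A, B⟩ -
    refine Prod.ext (funext fun i => ?_) (funext fun i => ?_) <;>
      by_cases hi : i ∈ S <;> simp [hi]
  · rintro ⟨A, B⟩ -
    refine Prod.ext (funext fun i => ?_) (funext fun i => ?_) <;>
      by_cases hi : i ∈ S <;> simp [hi]

lemma card_filter_restrict_le (S : Finset ι) (P : (S → Ω) → Prop) [DecidablePred P] {p : ℝ}
    (hP : (Nat.card {a : S → Ω // P a} : ℝ) ≤ p * (Fintype.card Ω : ℝ) ^ S.card) :
    ((Finset.univ.filter fun A : ι → Ω => P fun i => A i).card : ℝ) ≤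
      p * Fintype.card (ι → Ω) := by
  classical
  have h1 : (Finset.univ.filter fun A : ι → Ω => P fun i => A i).card ≤
      Nat.card ({a : S → Ω // P a} × ({i // i ∉ S} → Ω)) := by
    rw [← Fintype.card_subtype, ← Nat.card_eq_fintype_card]
    refine Nat.card_le_card_of_injective
      (fun A => (⟨fun i => A.1 i, A.2⟩, fun i => A.1 i)) fun A B hAB => ?_
    simp only [Prod.mk.injEq, Subtype.mk.injEq, funext_iff, Subtype.forall] at hAB
    refine Subtype.ext (funext fun i => ?_)
    by_cases hi : i ∈ S
    · exact hAB.1 i hi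
    · exact hAB.2 i hi
  have h2 : Fintype.card (ι → Ω) = Fintype.card Ω ^ S.card * Nat.card ({i // i ∉ S} → Ω) := by
    rw [Fintype.card_congr (Equiv.piEquivPiSubtypeProd (fun i => i ∈ S) fun _ => Ω),
      Fintype.card_prod, Nat.card_eq_fintype_card, Fintype.card_fun, Fintype.card_coe]
  rw [Nat.card_prod] at h1
  calc ((Finset.univ.filter fun A : ι → Ω => P fun i => A i).card : ℝ)
      ≤ (Nat.card {a : S → Ω // P a} : ℝ) * Nat.card ({i // i ∉ S} → Ω) := by exact_mod_cast h1
    _ ≤ p * (Fintype.card Ω : ℝ) ^ S.card * Nat.card ({i // i ∉ S} → Ω) := by gcongr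
    _ = p * Fintype.card (ι → Ω) := by rw [h2]; push_cast; ring

lemma inv_exp_le_one_sub_inv_pow {α : ℕ} (hα : 2 ≤ α) :
    1 ≤ Real.exp 1 * (1 - 1 / (α : ℝ)) ^ (α - 1) := by
  obtain ⟨k, rfl⟩ : ∃ k, α = k + 1 := ⟨α - 1, by omega⟩
  have hk : (0 : ℝ) < k := by
    have : 1 ≤ k := by omega
    exact_mod_cast this
  have h1 : (1 + 1 / (k : ℝ)) ^ k ≤ Real.exp 1 := by
    calc (1 + 1 / (k : ℝ)) ^ k ≤ (Real.exp (1 / k)) ^ k := by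
          gcongr
          linarith [Real.add_one_le_exp (1 / (k : ℝ))]
      _ = Real.exp 1 := by
          rw [← Real.exp_nat_mul]
          congr 1
          field_simp
  have h2 : (1 - 1 / ((k + 1 : ℕ) : ℝ)) * (1 + 1 / (k : ℝ)) = 1 := by
    push_cast
    field_simp
    ring
  rw [Nat.add_sub_cancel]
  have h3 : 0 ≤ 1 - 1 / ((k + 1 : ℕ) : ℝ) := by
    push_cast
    rw [sub_nonneg, div_le_one (by positivity)]
    linarith
  calc (1 : ℝ) = (1 + 1 / (k : ℝ)) ^ k * (1 - 1 / ((k + 1 : ℕ) : ℝ)) ^ k := by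
        rw [← mul_pow, mul_comm, h2, one_pow]
    _ ≤ _ := by gcongr

/-- Forbidden patterns on the `α`-subsets of the coordinates can be avoided if each has a density
`p` with `e α (n - 1 choose α - 1) p ≤ 1`. Adding one coordinate to a set `X` multiplies the
density of the assignments that avoid the patterns inside `X` by at least `x = 1 - 1 / α`:
an assignment that is lost violates a pattern on some `S` and avoids those inside `X \ S`, which
depend on other coordinates, and by induction the density for `X \ S` is at most
`x ^ (-(α - 1))` times that for `X`. -/
lemma exists_forall_not_bad [Nonempty Ω] {α : ℕ} (hα : 2 ≤ α)
    (Bad : (S : Finset ι) → (S → Ω) → Prop) {p : ℝ} (hp : 0 ≤ p)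
    (hbad : ∀ S : Finset ι, S.card = α →
      (Nat.card {a : S → Ω // Bad S a} : ℝ) ≤ p * (Fintype.card Ω : ℝ) ^ α)
    (hpe : Real.exp 1 * α * ((Fintype.card ι - 1).choose (α - 1) : ℕ) * p ≤ 1) :
    ∃ A : ι → Ω, ∀ S : Finset ι, S.card = α → ¬ Bad S fun i => A i := by
  classical
  set N := Fintype.card (ι → Ω) with hN
  have hN0 : (0 : ℝ) < N := by
    rw [hN]
    exact_mod_cast Fintype.card_pos
  set x : ℝ := 1 - 1 / (α : ℝ) with hx
  have hα0 : (0 : ℝ) < α := by positivity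
  have hα2 : (2 : ℝ) ≤ α := by exact_mod_cast hα
  have hx0 : 0 < x := by
    rw [hx, sub_pos, div_lt_one hα0]
    linarith
  have hx1 : x ≤ 1 := by
    rw [hx]
    have : 0 ≤ 1 / (α : ℝ) := by positivity
    linarith
  let G : Finset ι → Finset (ι → Ω) := fun X =>
    Finset.univ.filter fun A => ∀ S ⊆ X, S.card = α → ¬ Bad S fun i => A i
  have step : ∀ n : ℕ, ∀ X : Finset ι, X.card = n → ∀ i ∉ X,
      x * ((G X).card : ℝ) ≤ ((G (insert i X)).card : ℝ) := by
    intro n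
    induction n using Nat.strong_induction_on with
    | _ n ih =>
    intro X hX i hi
    -- Adding the coordinates of `X \ Y` to `Y` one at a time.
    have remove : ∀ T : Finset ι, ∀ Y ⊆ X, T.card = X.card - Y.card → T = X \ Y →
        x ^ T.card * ((G Y).card : ℝ) ≤ (G X).card := by
      intro T
      induction T using Finset.induction_on with
      | empty =>
        intro Y hY _ hT
        have : Y = X := hY.antisymm (Finset.sdiff_eq_empty_iff_subset.1 hT.symm)
        simp [this]
      | insert a T ha ihT =>
        intro Y hY hc hT
        have haX : a ∈ X \ Y := hT ▸ Finset.mem_insert_self a T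
        obtain ⟨haX, haY⟩ := Finset.mem_sdiff.1 haX
        have hYX : insert a Y ⊆ X := Finset.insert_subset haX hY
        have h1 := ih Y.card (by
          rw [← hX]
          exact Finset.card_lt_card ⟨hY, fun h => haY (h haX)⟩) Y rfl a haY
        have h2 : T = X \ insert a Y := by
          rw [Finset.sdiff_insert, ← hT, Finset.erase_insert ha]
        have h3 := ihT (insert a Y) hYX (by
          rw [h2, Finset.card_sdiff_of_subset hYX]) h2
        rw [Finset.card_insert_of_notMem ha, pow_succ, mul_assoc]
        exact (mul_le_mul_of_nonneg_left h1 (by positivity)).trans h3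
    let 𝒮 : Finset (Finset ι) := (insert i X).powersetCard α |>.filter fun S => i ∈ S
    -- `L S` contains the assignments that are good on `X` but violate the pattern on `S ∋ i`.
    let L : Finset ι → Finset (ι → Ω) := fun S =>
      Finset.univ.filter fun A => (Bad S fun i => A i) ∧
        ∀ S' ⊆ X \ S, S'.card = α → ¬ Bad S' fun i => A i
    have hsub : G X ⊆ G (insert i X) ∪ 𝒮.biUnion L := by
      intro A hA
      rw [Finset.mem_union]
      by_contra! hcon
      refine hcon.1 (Finset.mem_filter.2 ⟨Finset.mem_univ _, fun S hS hSα hB => ?_⟩)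
      have hA' := (Finset.mem_filter.1 hA).2
      by_cases hiS : i ∈ S
      · exact hcon.2 (Finset.mem_biUnion.2 ⟨S, Finset.mem_filter.2
          ⟨Finset.mem_powersetCard.2 ⟨hS, hSα⟩, hiS⟩, Finset.mem_filter.2
          ⟨Finset.mem_univ _, hB, fun S' hS' => hA' S' (hS'.trans Finset.sdiff_subset)⟩⟩)
      · exact hA' S ((Finset.subset_insert_iff_of_notMem hiS).1 hS) hSα hB
    have hL : ∀ S ∈ 𝒮, ((L S).card : ℝ) ≤ Real.exp 1 * p * (G X).card := by
      intro S hS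
      obtain ⟨hS, hiS⟩ := Finset.mem_filter.1 hS
      obtain ⟨hSX, hSα⟩ := Finset.mem_powersetCard.1 hS
      have h1 := card_and_mul_card_eq S (fun A : ι → Ω => Bad S fun i => A i)
        (fun A : ι → Ω => ∀ S' ⊆ X \ S, S'.card = α → ¬ Bad S' fun i => A i)
        (fun A B hAB hA => by
          have : (fun i : S => A i) = fun i : S => B i := funext fun i => hAB i i.2
          rwa [← this])
        (fun A B hAB hA S' hS' hc => by
          have : (fun i : S' => A i) = fun i : S' => B i :=
            funext fun i => hAB i (Finset.mem_sdiff.1 (hS' i.2)).2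
          rw [← this]
          exact hA S' hS' hc)
      have h2 := card_filter_restrict_le S (Bad S) (p := p) (by
        rw [hSα]
        exact hbad S hSα)
      have h3 : ((L S).card : ℝ) * N ≤ p * N * (G (X \ S)).card := by
        have : ((L S).card : ℝ) * N =
            ((Finset.univ.filter fun A : ι → Ω => Bad S fun i => A i).card : ℝ) *
              (G (X \ S)).card := by exact_mod_cast h1
        rw [this]
        gcongr
      have h4 : ((L S).card : ℝ) ≤ p * (G (X \ S)).card := by
        refine le_of_mul_le_mul_right (h3.trans_eq ?_) hN0
        ring
      have h5 := remove _ (X \ S) Finset.sdiff_subset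
        (Finset.card_sdiff_of_subset Finset.sdiff_subset) rfl
      have h6 : (X \ (X \ S)).card ≤ α - 1 := by
        rw [← hSα, ← Finset.card_erase_of_mem hiS]
        refine Finset.card_le_card fun a ha => ?_
        rw [sdiff_sdiff_right_self, Finset.inf_eq_inter, Finset.mem_inter] at ha
        exact Finset.mem_erase.2 ⟨fun h => hi (h ▸ ha.1), ha.2⟩
      have h7 : ((G (X \ S)).card : ℝ) ≤ Real.exp 1 * (G X).card :=
        calc ((G (X \ S)).card : ℝ)
            ≤ Real.exp 1 * x ^ (α - 1) * (G (X \ S)).card :=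
              le_mul_of_one_le_left (by positivity) (inv_exp_le_one_sub_inv_pow hα)
          _ ≤ Real.exp 1 * x ^ (X \ (X \ S)).card * (G (X \ S)).card := by
              gcongr ?_ * ?_ * _
              exact pow_le_pow_of_le_one hx0.le hx1 h6
          _ = Real.exp 1 * (x ^ (X \ (X \ S)).card * (G (X \ S)).card) := by ring
          _ ≤ _ := by gcongr
      calc ((L S).card : ℝ) ≤ p * (G (X \ S)).card := h4
        _ ≤ p * (Real.exp 1 * (G X).card) := by gcongr
        _ = _ := by ring
    have h𝒮 : 𝒮.card ≤ (Fintype.card ι - 1).choose (α - 1) := by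
      rw [← Finset.card_univ, ← Finset.card_erase_of_mem (Finset.mem_univ i),
        ← Finset.card_powersetCard]
      refine Finset.card_le_card_of_injOn (fun S => S.erase i) (fun S hS => ?_) ?_
      · obtain ⟨hS, hiS⟩ := Finset.mem_filter.1 hS
        refine Finset.mem_powersetCard.2 ⟨Finset.erase_subset_erase _ (Finset.subset_univ _), ?_⟩
        rw [Finset.card_erase_of_mem hiS, (Finset.mem_powersetCard.1 hS).2]
      · intro S hS S' hS' h
        rw [← Finset.insert_erase (Finset.mem_filter.1 hS).2,
          ← Finset.insert_erase (Finset.mem_filter.1 hS').2]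
        exact congrArg _ h
    have hcard : ((G X).card : ℝ) ≤ (G (insert i X)).card + ∑ S ∈ 𝒮, ((L S).card : ℝ) := by
      have := (Finset.card_le_card hsub).trans ((Finset.card_union_le _ _).trans
        (Nat.add_le_add_left Finset.card_biUnion_le _))
      exact_mod_cast this
    have hsum : ∑ S ∈ 𝒮, ((L S).card : ℝ) ≤ 1 / α * (G X).card := by
      have h1 := Finset.sum_le_card_nsmul 𝒮 _ _ hL
      rw [nsmul_eq_mul] at h1
      refine h1.trans ?_
      rw [← mul_assoc]
      refine mul_le_mul_of_nonneg_right ?_ (by positivity)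
      rw [le_div_iff₀ hα0]
      refine le_trans ?_ hpe
      calc (𝒮.card : ℝ) * (Real.exp 1 * p) * α
          ≤ ((Fintype.card ι - 1).choose (α - 1) : ℕ) * (Real.exp 1 * p) * α := by gcongr
        _ = _ := by ring
    rw [hx, sub_mul, one_mul]
    linarith
  have hpos : ∀ X : Finset ι, (0 : ℝ) < (G X).card := by
    intro X
    induction X using Finset.induction_on with
    | empty =>
      have : G ∅ = Finset.univ := by
        refine Finset.filter_true_of_mem fun A _ S hS hSα => ?_
        rw [Finset.subset_empty.1 hS, Finset.card_empty] at hSα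
        omega
      rw [this, Finset.card_univ]
      exact hN0
    | insert i X hi ih =>
      exact (mul_pos hx0 ih).trans_le (step X.card X rfl i hi)
  obtain ⟨A, hA⟩ := Finset.card_pos.1 (Nat.cast_pos.1 (hpos Finset.univ))
  exact ⟨A, fun S hS => (Finset.mem_filter.1 hA).2 S (Finset.subset_univ _) hS⟩

end Counting

/-! ### Solutions from random coding coefficients -/

/-- Let `k = ε t + 1` and let `d = (α ℓ + ε - h) t + 1`. The messages that `α` middle nodes with
random coefficients jointly fail to see form a space of dimension at least `k` with probability
at most `γ q ^ (-k d)`, so the local lemma applies if `e γ α (r - 1 choose α - 1) ≤ q ^ (k d)`. -/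
lemma hasLinearSolution_of_choose_le {α ℓ ε h r q t : ℕ} (hα : 2 ≤ α)
    (hup : h ≤ α * ℓ + ε) {F : Type} [Field F] [Finite F] (hq : Nat.card F = q)
    (hr : Real.exp 1 * gam * α * ((r - 1).choose (α - 1) : ℕ) ≤
      (q : ℝ) ^ ((ε * t + 1) * ((α * ℓ + ε - h) * t + 1))) :
    HasLinearSolution α ℓ ε h r q t := by
  classical
  have := Fintype.ofFinite F
  subst hq
  set q := Nat.card F
  set k := ε * t + 1 with hk
  set d := (α * ℓ + ε - h) * t + 1 with hd
  have hq2 : 2 ≤ q := Finite.one_lt_card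
  have hq0 : (0 : ℝ) < q := by positivity
  have hgam : 0 < gam := by norm_num [gam]
  let V := Fin (h * t) → F
  let W := Fin (ℓ * t) → F
  have : Finite (V →ₗ[F] W) := Module.finite_of_finite F
  have := Fintype.ofFinite (V →ₗ[F] W)
  have hΩ : Fintype.card (V →ₗ[F] W) = q ^ (h * t * (ℓ * t)) := by
    rw [← Nat.card_eq_fintype_card, Module.natCard_eq_pow_finrank (K := F),
      Module.finrank_linearMap]
    simp [V, W, q]
  have hex := exists_forall_not_bad (ι := Fin r) (Ω := V →ₗ[F] W) hα
    (fun S a => k ≤ Module.finrank F (LinearMap.ker (LinearMap.pi a)))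
    (p := gam / (q : ℝ) ^ (k * d)) (by positivity) ?_ ?_
  · obtain ⟨φ, hφ⟩ := hex
    refine hasLinearSolution_of_finrank_ker_stack_le φ fun S hS => ?_
    have := hφ S hS
    rw [not_le, Nat.lt_succ_iff] at this
    exact this
  · intro S hS
    have : Finite (V →ₗ[F] (S → W)) := Module.finite_of_finite F
    have h1 : Nat.card {a : S → V →ₗ[F] W //
        k ≤ Module.finrank F (LinearMap.ker (LinearMap.pi a))} ≤
        Nat.card {X : V →ₗ[F] (S → W) // k ≤ Module.finrank F (LinearMap.ker X)} := by
      refine Nat.card_le_card_of_injective (fun a => ⟨LinearMap.pi a.1, a.2⟩) fun a b hab => ?_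
      refine Subtype.ext (funext fun i => LinearMap.ext fun v => ?_)
      exact congrFun (LinearMap.congr_fun (congrArg Subtype.val hab) v) i
    have h2 := card_finrank_ker_ge_mul_le (F := F) (V := V) (W := S → W) k
    have hV : Module.finrank F V = h * t := by simp [V]
    have hW : Module.finrank F (S → W) = α * (ℓ * t) := by
      rw [Module.finrank_pi_fintype]
      simp [W, hS]
    rw [hV, hW] at h2
    have h3 := pow_le_gam_mul_numFrames hq2 k
    have h4 : k + α * (ℓ * t) = d + h * t := by
      obtain ⟨c, hc⟩ := Nat.exists_eq_add_of_le hup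
      have : α * (ℓ * t) + ε * t = h * t + c * t := by
        rw [← mul_assoc, ← add_mul, hc, add_mul]
      rw [hk, hd, hc, Nat.add_sub_cancel_left]
      omega
    set n : ℕ := Nat.card {X : V →ₗ[F] (S → W) // k ≤ Module.finrank F (LinearMap.ker X)}
    have h5 : (n : ℝ) * numFrames q k * (q : ℝ) ^ (α * (ℓ * t) * k) ≤
        (q : ℝ) ^ (h * t * k + α * (ℓ * t) * (h * t)) := by exact_mod_cast h2
    have h6 : (n : ℝ) ≤ gam / (q : ℝ) ^ (k * d) * (Fintype.card (V →ₗ[F] W) : ℝ) ^ α := by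
      rw [hΩ, div_mul_eq_mul_div, le_div_iff₀ (by positivity)]
      refine le_of_mul_le_mul_right (a := (q : ℝ) ^ (h * t * k)) ?_ (by positivity)
      have h7 : k * d + h * t * k = k * k + α * (ℓ * t) * k := by
        have : k * (k + α * (ℓ * t)) = k * (d + h * t) := by rw [h4]
        nlinarith
      calc (n : ℝ) * (q : ℝ) ^ (k * d) * (q : ℝ) ^ (h * t * k)
          = n * (q : ℝ) ^ (k * k) * (q : ℝ) ^ (α * (ℓ * t) * k) := by
            rw [mul_assoc, ← pow_add, h7, pow_add]
            ring
        _ ≤ n * (gam * numFrames q k) * (q : ℝ) ^ (α * (ℓ * t) * k) := by gcongr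
        _ = gam * (n * numFrames q k * (q : ℝ) ^ (α * (ℓ * t) * k)) := by ring
        _ ≤ gam * (q : ℝ) ^ (h * t * k + α * (ℓ * t) * (h * t)) := by gcongr
        _ = _ := by
          push_cast
          ring
    refine le_trans ?_ h6
    exact_mod_cast h1
  · rw [Fintype.card_fin, mul_div_assoc', div_le_one (by positivity)]
    refine le_trans (le_of_eq ?_) hr
    ring

/-! ### Solutions from rank-metric codes -/

section Gabidulin

open Polynomial

variable {m : ℕ}

/-- The linearized polynomial `∑ a_i X ^ (2 ^ i)`. -/
noncomputable def linearizedPoly {k : ℕ} (a : Fin k → GaloisField 2 m) : (GaloisField 2 m)[X] :=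
  ∑ i : Fin k, C (a i) * X ^ 2 ^ i.val

/-- The map `x ↦ ∑ a_i x ^ (2 ^ i)`, which is linear over the field with two elements. -/
noncomputable def linearizedMap {k : ℕ} (a : Fin k → GaloisField 2 m) :
    GaloisField 2 m →ₗ[ZMod 2] GaloisField 2 m :=
  AddMonoidHom.toZModLinearMap 2
    { toFun := fun x => ∑ i : Fin k, a i * x ^ 2 ^ i.val
      map_zero' := by simp
      map_add' := fun x y => by
        simp only [add_pow_char_pow, mul_add, Finset.sum_add_distrib] }

lemma linearizedMap_apply {k : ℕ} (a : Fin k → GaloisField 2 m) (x : GaloisField 2 m) :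
    linearizedMap a x = ∑ i : Fin k, a i * x ^ 2 ^ i.val := rfl

lemma linearizedMap_sub {k : ℕ} (a b : Fin k → GaloisField 2 m) :
    linearizedMap (a - b) = linearizedMap a - linearizedMap b := by
  ext x
  simp [linearizedMap_apply, sub_mul]

lemma finrank_ker_linearizedMap_lt {k : ℕ} {a : Fin k → GaloisField 2 m} (ha : a ≠ 0) :
    Module.finrank (ZMod 2) (LinearMap.ker (linearizedMap a)) < k := by
  classical
  obtain ⟨i, hi⟩ := Function.ne_iff.1 ha
  have hne : linearizedPoly a ≠ 0 := by
    intro h0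
    refine hi ?_
    have h1 := congrArg (fun p => p.coeff (2 ^ i.val)) h0
    simp only [linearizedPoly, finsetSum_coeff, coeff_C_mul_X_pow, coeff_zero] at h1
    rw [Finset.sum_eq_single i] at h1
    · simpa using h1
    · intro j _ hj
      rw [if_neg]
      intro h
      exact hj (Fin.ext (Nat.pow_right_injective le_rfl h).symm)
    · simp
  have hdeg : (linearizedPoly a).natDegree < 2 ^ k := by
    refine lt_of_le_of_lt (natDegree_sum_le_of_forall_le (n := 2 ^ (k - 1)) _ _ fun j _ => ?_) ?_
    · refine (natDegree_C_mul_X_pow_le _ _).trans (Nat.pow_le_pow_right two_pos ?_)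
      omega
    · have := i.isLt
      exact Nat.pow_lt_pow_right one_lt_two (by omega)
  have hfin : Finite (GaloisField 2 m) := inferInstance
  have := Fintype.ofFinite (GaloisField 2 m)
  have hcard : Nat.card (LinearMap.ker (linearizedMap a)) ≤ (linearizedPoly a).natDegree := by
    refine le_trans ?_ ((Multiset.toFinset_card_le _).trans (card_roots' (linearizedPoly a)))
    rw [← Set.ncard_coe_finset]
    refine Set.ncard_le_ncard (s := (LinearMap.ker (linearizedMap a) : Set (GaloisField 2 m)))
      (fun x hx => ?_) (Finset.finite_toSet _)
    have hx0 : ∑ i : Fin k, a i * x ^ 2 ^ i.val = 0 := hx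
    rw [Finset.mem_coe, Multiset.mem_toFinset, mem_roots hne, IsRoot.def, linearizedPoly,
      eval_finsetSum]
    simpa using hx0
  rw [Module.natCard_eq_pow_finrank (K := ZMod 2), Nat.card_zmod] at hcard
  exact (Nat.pow_lt_pow_iff_right one_lt_two).1 (hcard.trans_lt hdeg)

/-- Gabidulin codes: linear maps from a space of dimension `n ≤ m` to one of dimension `m`, given
by linearized polynomials, such that the difference of two of them has a kernel of dimension less
than `k`. -/
lemma exists_rankMetricCode {m n : ℕ} (k : ℕ) (hm : m ≠ 0) (hn : n ≤ m) :
    ∃ c : Fin (2 ^ (m * k)) → (Fin n → ZMod 2) →ₗ[ZMod 2] (Fin m → ZMod 2),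
      ∀ i j, i ≠ j → Module.finrank (ZMod 2) (LinearMap.ker (c i - c j)) < k := by
  have hcard : Nat.card (Fin k → GaloisField 2 m) = 2 ^ (m * k) := by
    rw [Nat.card_fun, GaloisField.card 2 m hm, Nat.card_fin, pow_mul]
  let e : Fin (2 ^ (m * k)) ≃ (Fin k → GaloisField 2 m) :=
    (finCongr hcard.symm).trans (Finite.equivFin _).symm
  have hfr : Module.finrank (ZMod 2) (GaloisField 2 m) = m := GaloisField.finrank 2 hm
  let u : GaloisField 2 m ≃ₗ[ZMod 2] (Fin m → ZMod 2) :=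
    LinearEquiv.ofFinrankEq _ _ (by rw [hfr, Module.finrank_fin_fun])
  obtain ⟨s, hs⟩ := exists_linearIndependent_of_le_finrank (R := ZMod 2)
    (M := GaloisField 2 m) (n := n) (by rw [hfr]; exact hn)
  let v : (Fin n → ZMod 2) →ₗ[ZMod 2] GaloisField 2 m := (Pi.basisFun (ZMod 2) (Fin n)).constr ℕ s
  have hv : Function.Injective v :=
    (Pi.basisFun (ZMod 2) (Fin n)).injective_constr_of_linearIndependent hs
  refine ⟨fun i => u.toLinearMap ∘ₗ linearizedMap (e i) ∘ₗ v, fun i j hij => ?_⟩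
  have hne : e i - e j ≠ 0 := sub_ne_zero.2 (e.injective.ne hij)
  refine lt_of_le_of_lt ?_ (finrank_ker_linearizedMap_lt hne)
  refine LinearMap.finrank_le_finrank_of_injective
    (f := (v.domRestrict _).codRestrict _ fun x => ?_) ?_
  · rw [LinearMap.mem_ker, linearizedMap_sub]
    refine u.injective ?_
    rw [LinearMap.sub_apply, map_sub, map_zero]
    exact x.2
  · intro x y hxy
    exact Subtype.ext (hv (congrArg Subtype.val hxy))

end Gabidulin

/-- For `t ≥ 1` the exponent `g(t)` is a natural number `n`, and there is a rank-metric code with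
`2 ^ n` elements whose differences have kernels of dimension at most `ε t`. The Gabidulin code is
transposed if the domain is larger than the codomain. -/
lemma exists_code_card_two_pow_g {ℓ ε h t : ℕ} (hℓ : 1 ≤ ℓ) (ht : 1 ≤ t) (hlow : ℓ + ε < h)
    (hh : h < 2 * ℓ + ε) :
    ∃ n : ℕ, (n : ℝ) = g ℓ ε h t ∧
      ∃ c : Fin (2 ^ n) → (Fin ((h - ℓ) * t) → ZMod 2) →ₗ[ZMod 2] (Fin (ℓ * t) → ZMod 2),
        ∀ i j, i ≠ j → Module.finrank (ZMod 2) (LinearMap.ker (c i - c j)) ≤ ε * t := by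
  have ht0 : (0 : ℝ) ≤ t := by positivity
  by_cases hcase : h ≤ 2 * ℓ
  · refine ⟨ℓ * t * (ε * t + 1), ?_, ?_⟩
    · have h1 : ((h : ℝ) - ℓ) * t ≤ ℓ * t := by
        have : (h : ℝ) ≤ 2 * ℓ := by exact_mod_cast hcase
        exact mul_le_mul_of_nonneg_right (by linarith) ht0
      rw [g, max_eq_left h1, min_eq_right h1]
      push_cast
      ring
    · obtain ⟨c, hc⟩ := exists_rankMetricCode (m := ℓ * t) (n := (h - ℓ) * t) (ε * t + 1)
        (by positivity) (Nat.mul_le_mul_right _ (by omega))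
      exact ⟨c, fun i j hij => Nat.lt_succ_iff.1 (hc i j hij)⟩
  · push Not at hcase
    refine ⟨(h - ℓ) * t * ((2 * ℓ + ε - h) * t + 1), ?_, ?_⟩
    · have h1 : (ℓ : ℝ) * t ≤ ((h : ℝ) - ℓ) * t := by
        have : 2 * (ℓ : ℝ) ≤ h := by exact_mod_cast hcase.le
        exact mul_le_mul_of_nonneg_right (by linarith) ht0
      rw [g, max_eq_right h1, min_eq_left h1]
      push_cast [Nat.cast_sub (show ℓ ≤ h by omega), Nat.cast_sub hh.le]
      ring
    · obtain ⟨c, hc⟩ := exists_rankMetricCode (m := (h - ℓ) * t) (n := ℓ * t)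
        ((2 * ℓ + ε - h) * t + 1) (Nat.mul_ne_zero (by omega) (by omega))
        (Nat.mul_le_mul_right _ (by omega))
      refine ⟨fun i => Matrix.mulVecLin (LinearMap.toMatrix' (c i)).transpose,
        fun i j hij => ?_⟩
      -- Transposition preserves the rank, so the kernels have the same codimension.
      have h1 := Nat.lt_succ_iff.1 (hc i j hij)
      have h2 := (c i - c j).finrank_range_add_finrank_ker
      have h3 := (Matrix.mulVecLin (LinearMap.toMatrix' (c i - c j)).transpose
        ).finrank_range_add_finrank_ker
      have h4 := Matrix.rank_transpose (LinearMap.toMatrix' (c i - c j))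
      rw [Matrix.rank, Matrix.rank, ← Matrix.toLin'_apply' (LinearMap.toMatrix' (c i - c j)),
        Matrix.toLin'_toMatrix'] at h4
      have h5 : Matrix.mulVecLin (LinearMap.toMatrix' (c i)).transpose -
          Matrix.mulVecLin (LinearMap.toMatrix' (c j)).transpose =
          Matrix.mulVecLin (LinearMap.toMatrix' (c i - c j)).transpose := by
        ext x : 2
        simp
      rw [h5]
      rw [Module.finrank_fin_fun] at h2 h3
      have h6 : (2 * ℓ + ε - h) * t + (h - ℓ) * t = ε * t + ℓ * t := by
        rw [← add_mul, ← add_mul]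
        congr 1
        omega
      omega

/-- Each map `c` of the code gives coefficients `[I | c]`, used at no more than `α - 1` middle
nodes. Any `α` middle nodes then use two different elements of the code, and what both fail to see
is isomorphic to the kernel of their difference. -/
lemma hasLinearSolution_of_code {α ℓ ε h r t n : ℕ} (hα : 2 ≤ α) (hlow : ℓ ≤ h)
    (c : Fin n → (Fin ((h - ℓ) * t) → ZMod 2) →ₗ[ZMod 2] (Fin (ℓ * t) → ZMod 2))
    (hc : ∀ i j, i ≠ j → Module.finrank (ZMod 2) (LinearMap.ker (c i - c j)) ≤ ε * t)
    (hr : r ≤ (α - 1) * n) : HasLinearSolution α ℓ ε h r 2 t := by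
  let u : (Fin (h * t) → ZMod 2) ≃ₗ[ZMod 2]
      (Fin (ℓ * t) → ZMod 2) × (Fin ((h - ℓ) * t) → ZMod 2) :=
    LinearEquiv.ofFinrankEq _ _ (by
      rw [Module.finrank_prod, Module.finrank_fin_fun, Module.finrank_fin_fun,
        Module.finrank_fin_fun, ← add_mul, Nat.add_sub_cancel' hlow])
  let idx : Fin r → Fin n := fun i => ⟨i / (α - 1), Nat.div_lt_of_lt_mul (i.2.trans_le hr)⟩
  let φ : Fin r → (Fin (h * t) → ZMod 2) →ₗ[ZMod 2] (Fin (ℓ * t) → ZMod 2) := fun i =>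
    (LinearMap.coprod LinearMap.id (c (idx i))) ∘ₗ u.toLinearMap
  have hsol := hasLinearSolution_of_finrank_ker_stack_le (F := ZMod 2) (α := α) (ε := ε) φ
  rw [Nat.card_zmod] at hsol
  refine hsol fun S hS => ?_
  obtain ⟨i, hi, j, hj, hij⟩ : ∃ i ∈ S, ∃ j ∈ S, idx i ≠ idx j := by
    by_contra! hall
    have hlt : (Finset.range (α - 1)).card < S.card := by
      rw [Finset.card_range, hS]
      omega
    obtain ⟨i, hi, j, hj, hij, hmod⟩ := Finset.exists_ne_map_eq_of_card_lt_of_maps_to hlt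
      (f := fun i : Fin r => i.val % (α - 1))
      (fun i _ => by simpa using Nat.mod_lt _ (by omega))
    refine hij (Fin.ext ?_)
    have hdiv : i.val / (α - 1) = j.val / (α - 1) := congrArg Fin.val (hall i hi j hj)
    rw [← Nat.div_add_mod i.val (α - 1), hdiv, hmod, Nat.div_add_mod]
  refine le_trans ?_ (hc _ _ hij)
  have hmem : ∀ x : LinearMap.ker (stack φ S), ∀ i ∈ S, (u x.1).1 + c (idx i) (u x.1).2 = 0 :=
    fun x i hi => mem_ker_stack.1 x.2 i hi
  refine LinearMap.finrank_le_finrank_of_injective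
    (f := ((LinearMap.snd _ _ _ ∘ₗ u.toLinearMap).domRestrict _).codRestrict _ fun x => ?_) ?_
  · rw [LinearMap.mem_ker, LinearMap.sub_apply, sub_eq_zero]
    exact add_left_cancel ((hmem x i hi).trans (hmem x j hj).symm)
  · rw [← LinearMap.ker_eq_bot, LinearMap.ker_eq_bot']
    intro x hx
    have h2 : (u x.1).2 = 0 := congrArg Subtype.val hx
    have h1 : (u x.1).1 = 0 := by simpa [h2] using hmem x i hi
    refine Subtype.ext (u.injective ?_)
    rw [Submodule.coe_zero, map_zero]
    exact Prod.ext h1 h2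

/-! ### The two optimal sizes and the gap -/

lemma HasLinearSolution.two_le {α ℓ ε h r q t : ℕ} (hsol : HasLinearSolution α ℓ ε h r q t) :
    2 ≤ q := by
  obtain ⟨F, _, _, rfl, -⟩ := hsol
  exact Finite.one_lt_card

/-- The prime given by Bertrand's postulate is large enough for random scalar coefficients. -/
lemma exists_mem_scalarSizes_le {α ℓ ε h r : ℕ} (hα : 2 ≤ α) (hup : h ≤ α * ℓ + ε) (hr : 1 ≤ r) :
    ∃ q ∈ scalarSizes α ℓ ε h r, q ≤ 20 * α * r ^ (α - 1) := by
  obtain ⟨p, hp, hlt, hle⟩ := Nat.exists_prime_lt_and_le_two_mul (10 * α * r ^ (α - 1))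
    (by positivity)
  have := Fact.mk hp
  refine ⟨p, hasLinearSolution_of_choose_le hα hup (F := ZMod p) (Nat.card_zmod p) ?_, by linarith⟩
  have h1 : ((r - 1).choose (α - 1) : ℝ) ≤ (r : ℝ) ^ (α - 1) := by
    exact_mod_cast (Nat.choose_le_pow _ _).trans (Nat.pow_le_pow_left (Nat.sub_le _ _) _)
  have h2 : Real.exp 1 * gam ≤ 10 := by
    have := Real.exp_one_lt_d9
    rw [gam]
    linarith
  have h3 : (1 : ℝ) ≤ p := by exact_mod_cast hp.one_le
  calc Real.exp 1 * gam * α * ((r - 1).choose (α - 1) : ℕ) ≤ 10 * α * (r : ℝ) ^ (α - 1) := by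
        gcongr
    _ ≤ p := by exact_mod_cast hlt.le
    _ ≤ _ := le_self_pow₀ h3 (by positivity)

lemma scalarSizes_subset_vectorSizes (α ℓ ε h r : ℕ) :
    scalarSizes α ℓ ε h r ⊆ vectorSizes α ℓ ε h r :=
  fun q hq => ⟨q, 1, le_rfl, (pow_one q).symm, hq⟩

section Gap

variable {α ℓ ε h r : ℕ}

lemma one_le_of_mem_vectorSizes {n : ℕ} (hn : n ∈ vectorSizes α ℓ ε h r) : 1 ≤ n := by
  obtain ⟨q, t, -, rfl, hsol⟩ := hn
  exact Nat.one_le_pow _ _ (by linarith [hsol.two_le])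

lemma hasLinearSolution_qs (hne : (scalarSizes α ℓ ε h r).Nonempty) :
    HasLinearSolution α ℓ ε h r (qs α ℓ ε h r) 1 :=
  Nat.sInf_mem hne

lemma one_le_qv (hne : (scalarSizes α ℓ ε h r).Nonempty) : 1 ≤ qv α ℓ ε h r :=
  one_le_of_mem_vectorSizes (Nat.sInf_mem (hne.mono (scalarSizes_subset_vectorSizes ..)))

lemma gap_nonneg (hne : (scalarSizes α ℓ ε h r).Nonempty) : 0 ≤ gap α ℓ ε h r := by
  rw [gap, sub_nonneg]
  have h1 : qv α ℓ ε h r ≤ qs α ℓ ε h r :=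
    Nat.sInf_le (scalarSizes_subset_vectorSizes _ _ _ _ _ (hasLinearSolution_qs hne))
  have h2 : (0 : ℝ) < qv α ℓ ε h r := by exact_mod_cast one_le_qv hne
  exact Real.logb_le_logb_of_le one_lt_two h2 (by exact_mod_cast h1)

lemma sub_le_gap (hne : (scalarSizes α ℓ ε h r).Nonempty) {t : ℕ} (ht : 1 ≤ t)
    (hsol : HasLinearSolution α ℓ ε h r 2 t) {L : ℝ} (hL : L ≤ Real.logb 2 (qs α ℓ ε h r)) :
    L - t ≤ gap α ℓ ε h r := by
  have h1 : qv α ℓ ε h r ≤ 2 ^ t := Nat.sInf_le ⟨2, t, ht, rfl, hsol⟩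
  have h2 : (0 : ℝ) < qv α ℓ ε h r := by exact_mod_cast one_le_qv hne
  have h3 : Real.logb 2 (qv α ℓ ε h r) ≤ t := by
    rw [Real.logb_le_iff_le_rpow one_lt_two h2, Real.rpow_natCast]
    exact_mod_cast h1
  rw [gap]
  linarith

lemma gap_le (hα : 2 ≤ α) (hup : h ≤ α * ℓ + ε) (hr : 1 ≤ r) :
    gap α ℓ ε h r ≤ Real.logb 2 (20 * α) + (α - 1) * Real.logb 2 r := by
  obtain ⟨q, hq, hle⟩ := exists_mem_scalarSizes_le hα hup hr
  have h1 : (qs α ℓ ε h r : ℝ) ≤ 20 * α * (r : ℝ) ^ (α - 1) := by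
    exact_mod_cast (Nat.sInf_le hq).trans hle
  have h2 : (0 : ℝ) < qs α ℓ ε h r := by
    exact_mod_cast two_pos.trans_le (hasLinearSolution_qs ⟨q, hq⟩).two_le
  have h3 : 0 ≤ Real.logb 2 (qv α ℓ ε h r) :=
    Real.logb_nonneg one_lt_two (by exact_mod_cast one_le_qv ⟨q, hq⟩)
  have h4 := Real.logb_le_logb_of_le one_lt_two h2 h1
  have hr0 : (r : ℝ) ≠ 0 := by positivity
  rw [Real.logb_mul (by positivity) (by positivity), Real.logb_pow, Nat.cast_sub (by omega),
    Nat.cast_one] at h4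
  rw [gap]
  linarith

lemma logb_div_le_logb_qs (hℓ : 1 ≤ ℓ) (hne : (scalarSizes α ℓ ε h r).Nonempty) {x c : ℝ}
    (hx : 0 < x) (hc : 0 < c) (hxc : x ≤ c * (gam * (qs α ℓ ε h r : ℝ) ^ (ℓ * (ε + 1)))) :
    Real.logb 2 (x / (gam * c)) / ((ℓ : ℝ) * (ε + 1)) ≤ Real.logb 2 (qs α ℓ ε h r) := by
  have hg : 0 < gam := by norm_num [gam]
  have hq : (0 : ℝ) < qs α ℓ ε h r := by
    exact_mod_cast two_pos.trans_le (hasLinearSolution_qs hne).two_le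
  have hℓ0 : (0 : ℝ) < ℓ := by exact_mod_cast hℓ
  rw [div_le_iff₀ (by positivity)]
  calc Real.logb 2 (x / (gam * c)) ≤ Real.logb 2 ((qs α ℓ ε h r : ℝ) ^ (ℓ * (ε + 1))) := by
        refine Real.logb_le_logb_of_le one_lt_two (by positivity) ?_
        rw [div_le_iff₀ (by positivity)]
        linarith
    _ = _ := by
        rw [Real.logb_pow]
        push_cast
        ring

end Gap

/-! ### Scalar solutions: the two ranges of `h` -/

lemma theta_eq {α ℓ ε h : ℕ} (hℓ : 1 ≤ ℓ) (hεh : ε ≤ h) :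
    theta α ℓ ε h = (α : ℝ) - ((h - ε) / ℓ : ℕ) + 1 := by
  have h1 : ⌊((h : ℝ) - ε) / ℓ⌋ = (((h - ε) / ℓ : ℕ) : ℤ) := by
    rw [← Nat.cast_sub hεh, ← Nat.floor_div_eq_div (K := ℝ),
      Int.natCast_floor_eq_floor (by positivity)]
  rw [theta, h1, Int.cast_natCast]

lemma one_le_theta {α ℓ ε h : ℕ} (hℓ : 1 ≤ ℓ) (hεh : ε ≤ h) (hup : h ≤ α * ℓ + ε) :
    1 ≤ theta α ℓ ε h := by
  rw [theta_eq hℓ hεh]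
  have : (h - ε) / ℓ ≤ α := Nat.div_le_of_le_mul (by rw [mul_comm]; omega)
  have : (((h - ε) / ℓ : ℕ) : ℝ) ≤ α := by exact_mod_cast this
  linarith

/-- The bound of `scalar_bound` in terms of `θ`. The quotient `⌊(h - ε - 1) / ℓ⌋` is smaller by one
than `⌊(h - ε) / ℓ⌋` if `ℓ` divides `h - ε`; otherwise they agree, and the factor `θ` could be
replaced by `θ - 1`. -/
lemma add_theta_sub_le {α ℓ ε h r q : ℕ} (hℓ : 1 ≤ ℓ) (hlow : ℓ + ε < h) (hup : h ≤ α * ℓ + ε)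
    (hsol : HasLinearSolution α ℓ ε h r q 1) :
    (r : ℝ) + theta α ℓ ε h - α ≤ theta α ℓ ε h * (gam * (q : ℝ) ^ (ℓ * (ε + 1))) := by
  have h1 := scalar_bound hℓ hlow hup hsol
  rw [theta_eq hℓ (by omega)]
  set Q := gam * (q : ℝ) ^ (ℓ * (ε + 1))
  have hQ : 0 ≤ Q := mul_nonneg (by norm_num [gam]) (by positivity)
  have h2 : (h - ε - 1) / ℓ ≤ (h - ε) / ℓ := Nat.div_le_div_right (Nat.sub_le _ _)
  have h3 : (h - ε) / ℓ ≤ (h - ε - 1) / ℓ + 1 := by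
    rw [← Nat.add_div_right _ hℓ]
    exact Nat.div_le_div_right (by omega)
  rcases h2.eq_or_lt with h4 | h4
  · rw [h4] at h1
    linarith
  · have h5 : (h - ε) / ℓ = (h - ε - 1) / ℓ + 1 := by omega
    rw [h5]
    push_cast
    linarith

lemma le_sub_one_mul {α ℓ ε h r q : ℕ} (hℓ : 1 ≤ ℓ) (hlow : ℓ + ε < h) (hup : h ≤ α * ℓ + ε)
    (hh : h < 2 * ℓ + ε) (hsol : HasLinearSolution α ℓ ε h r q 1) :
    (r : ℝ) ≤ ((α : ℝ) - 1) * (gam * (q : ℝ) ^ (ℓ * (ε + 1))) := by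
  have h1 := scalar_bound hℓ hlow hup hsol
  have h2 : (h - ε - 1) / ℓ = 1 :=
    Nat.div_eq_of_lt_le (by omega) (by omega)
  rw [h2, Nat.cast_one] at h1
  linarith

/-! ### Vector solutions over the field with two elements -/

lemma beta_pos (α : ℕ) (hα : 2 ≤ α) : 0 < beta α := by
  have : 0 < gam := by norm_num [gam]
  rw [beta]
  positivity

lemma beta_pow {α : ℕ} (hα : 2 ≤ α) :
    beta α ^ (α - 1) = (Nat.factorial (α - 1) : ℝ) / (2 * Real.exp 1 * gam * α) := by
  have : 0 < gam := by norm_num [gam]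
  have h1 : ((α : ℝ) - 1) = ((α - 1 : ℕ) : ℝ) := by
    rw [Nat.cast_sub (by omega), Nat.cast_one]
  rw [beta, h1, one_div, Real.rpow_inv_natCast_pow (by positivity) (by omega)]

lemma beta_le {α : ℕ} (hα : 2 ≤ α) : beta α ≤ α := by
  refine le_of_pow_le_pow_left₀ (n := α - 1) (by omega) (by positivity) ?_
  rw [beta_pow hα]
  have h1 : ((α - 1).factorial : ℝ) ≤ (α : ℝ) ^ (α - 1) := by
    exact_mod_cast (Nat.factorial_le_pow _).trans (Nat.pow_le_pow_left (Nat.sub_le _ _) _)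
  refine (div_le_self (by positivity) ?_).trans h1
  have h2 : 1 ≤ Real.exp 1 := Real.one_le_exp zero_le_one
  have h3 : (2 : ℝ) ≤ α := by exact_mod_cast hα
  have h4 : 1 ≤ Real.exp 1 * gam := by rw [gam]; linarith
  nlinarith

lemma f_eq {α ℓ ε h : ℕ} (hup : h ≤ α * ℓ + ε) (t : ℕ) :
    f α ℓ ε h t = (((ε * t + 1) * ((α * ℓ + ε - h) * t + 1) : ℕ) : ℝ) := by
  rw [f]
  push_cast [Nat.cast_sub hup]
  ring

lemma hasLinearSolution_of_le_rpow_f {α ℓ ε h r t : ℕ} (hα : 2 ≤ α)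
    (hup : h ≤ α * ℓ + ε)
    (ht : (r : ℝ) / beta α ≤ (2 : ℝ) ^ (f α ℓ ε h t / ((α : ℝ) - 1))) :
    HasLinearSolution α ℓ ε h r 2 t := by
  refine hasLinearSolution_of_choose_le hα hup (F := ZMod 2) (Nat.card_zmod 2) ?_
  have hg : 0 < gam := by norm_num [gam]
  have hβ := beta_pos α hα
  have hα1 : ((α : ℝ) - 1) = ((α - 1 : ℕ) : ℝ) := by
    rw [Nat.cast_sub (by omega), Nat.cast_one]
  have hα0 : ((α - 1 : ℕ) : ℝ) ≠ 0 := by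
    have : α - 1 ≠ 0 := by omega
    exact_mod_cast this
  rw [f_eq hup] at ht
  set n := (ε * t + 1) * ((α * ℓ + ε - h) * t + 1)
  have h1 := pow_le_pow_left₀ (by positivity) ht (α - 1)
  rw [← Real.rpow_mul_natCast (by norm_num), hα1, div_mul_cancel₀ _ hα0, Real.rpow_natCast,
    div_pow, beta_pow hα, div_div_eq_mul_div, div_le_iff₀ (by positivity)] at h1
  have h2 : ((r - 1).choose (α - 1) : ℝ) * (α - 1).factorial ≤ (r : ℝ) ^ (α - 1) := by
    have h3 := Nat.choose_le_pow_div (α := ℝ) (α - 1) (r - 1)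
    rw [le_div_iff₀ (by positivity)] at h3
    refine h3.trans ?_
    gcongr
    exact Nat.sub_le _ _
  have h4 : (0 : ℝ) < (α - 1).factorial := by positivity
  rw [Nat.cast_ofNat]
  refine le_of_mul_le_mul_right ?_ h4
  calc Real.exp 1 * gam * α * ((r - 1).choose (α - 1) : ℕ) * (α - 1).factorial
      = Real.exp 1 * gam * α * (((r - 1).choose (α - 1) : ℕ) * (α - 1).factorial) := by ring
    _ ≤ Real.exp 1 * gam * α * (r : ℝ) ^ (α - 1) := by gcongr
    _ ≤ 2 * (Real.exp 1 * gam * α * (r : ℝ) ^ (α - 1)) :=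
      le_mul_of_one_le_left (by positivity) one_le_two
    _ = (r : ℝ) ^ (α - 1) * (2 * Real.exp 1 * gam * α) := by ring
    _ ≤ _ := h1

lemma hasLinearSolution_of_le_rpow_g {α ℓ ε h r t : ℕ} (hα : 2 ≤ α) (hℓ : 1 ≤ ℓ) (ht : 1 ≤ t)
    (hlow : ℓ + ε < h) (hh : h < 2 * ℓ + ε)
    (hr : (r : ℝ) / ((α : ℝ) - 1) ≤ (2 : ℝ) ^ g ℓ ε h t) :
    HasLinearSolution α ℓ ε h r 2 t := by
  obtain ⟨n, hn, c, hc⟩ := exists_code_card_two_pow_g hℓ ht hlow hh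
  refine hasLinearSolution_of_code hα (by omega) c hc ?_
  have hα1 : ((α : ℝ) - 1) = ((α - 1 : ℕ) : ℝ) := by
    rw [Nat.cast_sub (by omega), Nat.cast_one]
  have hα0 : 0 < ((α - 1 : ℕ) : ℝ) := by
    have : 0 < α - 1 := by omega
    exact_mod_cast this
  rw [← hn, Real.rpow_natCast, hα1, div_le_iff₀ hα0] at hr
  have h1 : (r : ℝ) ≤ (((α - 1) * 2 ^ n : ℕ) : ℝ) := by
    push_cast
    linarith
  exact_mod_cast h1

/-! ### The exponents `f` and `g` -/

lemma le_f {α ℓ ε h : ℕ} (hup : h ≤ α * ℓ + ε) (hne : ε ≠ 0 ∨ h ≠ α * ℓ) (t : ℕ) :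
    (t : ℝ) ≤ f α ℓ ε h t := by
  rw [f_eq hup, Nat.cast_le]
  rcases Nat.eq_zero_or_pos ε with h0 | h0
  · have h1 := Nat.le_mul_of_pos_left t (show 0 < α * ℓ + ε - h by omega)
    exact (h1.trans (Nat.le_succ _)).trans (Nat.le_mul_of_pos_left _ (Nat.succ_pos _))
  · have h1 := Nat.le_mul_of_pos_left t h0
    exact (h1.trans (Nat.le_succ _)).trans (Nat.le_mul_of_pos_right _ (Nat.succ_pos _))

lemma mul_sq_le_f {α ℓ ε h : ℕ} (hup : h ≤ α * ℓ + ε) (t : ℕ) :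
    ((α : ℝ) * ℓ + ε - h) * ε * (t : ℝ) ^ 2 ≤ f α ℓ ε h t := by
  have h1 : (h : ℝ) ≤ α * ℓ + ε := by exact_mod_cast hup
  have h2 : 0 ≤ ((α : ℝ) * ℓ + 2 * ε - h) * t :=
    mul_nonneg (by linarith [(Nat.cast_nonneg ε : (0 : ℝ) ≤ ε)]) (by positivity)
  rw [f]
  linarith

lemma gLead_pos {ℓ ε h : ℕ} (hℓ : 1 ≤ ℓ) (hε : 1 ≤ ε) (hlow : ℓ + ε < h) (hh : h < 2 * ℓ + ε) :
    0 < gLead ℓ ε h := by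
  have h1 : (h : ℝ) < 2 * ℓ + ε := by exact_mod_cast hh
  have h2 : (ℓ : ℝ) + ε < h := by exact_mod_cast hlow
  have h3 : (1 : ℝ) ≤ ε := by exact_mod_cast hε
  have h4 : (1 : ℝ) ≤ ℓ := by exact_mod_cast hℓ
  rw [gLead]
  split_ifs
  · positivity
  · exact mul_pos (by linarith) (by linarith)

lemma le_g {ℓ ε h : ℕ} (hℓ : 1 ≤ ℓ) (hlow : ℓ + ε < h) (hh : h < 2 * ℓ + ε) (t : ℕ) :
    gLead ℓ ε h * (t : ℝ) ^ 2 + t ≤ g ℓ ε h t := by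
  have h1 : (h : ℝ) < 2 * ℓ + ε := by exact_mod_cast hh
  have h2 : (ℓ : ℝ) + ε + 1 ≤ h := by exact_mod_cast hlow
  have h3 : (0 : ℝ) ≤ ε := by positivity
  have h4 : (1 : ℝ) ≤ ℓ := by exact_mod_cast hℓ
  have ht : (0 : ℝ) ≤ t := by positivity
  rw [g, gLead]
  split_ifs with hcase
  · have h5 : (h : ℝ) ≤ 2 * ℓ := by exact_mod_cast hcase
    have h6 : ((h : ℝ) - ℓ) * t ≤ ℓ * t := mul_le_mul_of_nonneg_right (by linarith) ht
    rw [max_eq_left h6, min_eq_right h6]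
    nlinarith
  · have h5 : 2 * (ℓ : ℝ) ≤ h := by exact_mod_cast (not_le.1 hcase).le
    have h6 : (ℓ : ℝ) * t ≤ ((h : ℝ) - ℓ) * t := mul_le_mul_of_nonneg_right (by linarith) ht
    rw [max_eq_right h6, min_eq_left h6]
    nlinarith

lemma exists_isTDelta {α ℓ ε h r : ℕ} (hα : 2 ≤ α) (hup : h ≤ α * ℓ + ε)
    (hne : ε ≠ 0 ∨ h ≠ α * ℓ) (hr : 1 ≤ r) : ∃ t, IsTDelta α ℓ ε h r t := by
  have hβ := beta_pos α hα
  have hα1 : (0 : ℝ) < (α : ℝ) - 1 := by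
    have : (2 : ℝ) ≤ α := by exact_mod_cast hα
    linarith
  have hne : {t : ℕ | 1 ≤ t ∧
      (r : ℝ) / beta α ≤ (2 : ℝ) ^ (f α ℓ ε h t / ((α : ℝ) - 1))}.Nonempty := by
    obtain ⟨t, ht⟩ := exists_nat_ge (Real.logb 2 (r / beta α) * ((α : ℝ) - 1))
    refine ⟨t + 1, by omega, ?_⟩
    rw [← Real.logb_le_iff_le_rpow one_lt_two (by positivity), le_div_iff₀ hα1]
    have := le_f hup hne (t + 1)
    push_cast at this
    linarith
  exact ⟨_, Nat.sInf_mem hne, fun t ht => Nat.sInf_le ht⟩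

lemma exists_isTStar {α ℓ ε h r : ℕ} (hα : 2 ≤ α) (hℓ : 1 ≤ ℓ) (hlow : ℓ + ε < h)
    (hh : h < 2 * ℓ + ε) (hr : 1 ≤ r) : ∃ t, IsTStar α ℓ ε h r t := by
  have hα1 : (0 : ℝ) < (α : ℝ) - 1 := by
    have : (2 : ℝ) ≤ α := by exact_mod_cast hα
    linarith
  have hne : {t : ℕ | 1 ≤ t ∧ (r : ℝ) / ((α : ℝ) - 1) ≤ (2 : ℝ) ^ g ℓ ε h t}.Nonempty := by
    obtain ⟨t, ht⟩ := exists_nat_ge (Real.logb 2 (r / ((α : ℝ) - 1)))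
    refine ⟨t + 1, by omega, ?_⟩
    rw [← Real.logb_le_iff_le_rpow one_lt_two (by positivity)]
    have h1 := le_g hℓ hlow hh (t + 1)
    have h2 : 0 ≤ gLead ℓ ε h * ((t + 1 : ℕ) : ℝ) ^ 2 := by
      refine mul_nonneg ?_ (by positivity)
      have h3 : (h : ℝ) < 2 * ℓ + ε := by exact_mod_cast hh
      have h4 : (ℓ : ℝ) + ε < h := by exact_mod_cast hlow
      rw [gLead]
      split_ifs
      · positivity
      · exact mul_nonneg (by linarith [(Nat.cast_nonneg ε : (0 : ℝ) ≤ ε)]) (by linarith)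
    push_cast at h1 h2
    linarith
  exact ⟨_, Nat.sInf_mem hne, fun t ht => Nat.sInf_le ht⟩

/-! ### Explicit lower bounds -/

section Explicit

variable {α ℓ ε h r : ℕ}

lemma scalarSizes_nonempty (hα : 2 ≤ α) (hup : h ≤ α * ℓ + ε) (hr : 1 ≤ r) :
    (scalarSizes α ℓ ε h r).Nonempty := by
  obtain ⟨q, hq, -⟩ := exists_mem_scalarSizes_le hα hup hr
  exact ⟨q, hq⟩

lemma logb_theta_le_logb_qs (hα : 2 ≤ α) (hℓ : 1 ≤ ℓ) (hlow : ℓ + ε < h) (hup : h ≤ α * ℓ + ε)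
    (hr : 1 ≤ r) (hpos : 0 < (r : ℝ) + theta α ℓ ε h - α) :
    Real.logb 2 (((r : ℝ) + theta α ℓ ε h - α) / (gam * theta α ℓ ε h)) / ((ℓ : ℝ) * (ε + 1)) ≤
      Real.logb 2 (qs α ℓ ε h r) := by
  have hne := scalarSizes_nonempty hα hup hr
  exact logb_div_le_logb_qs hℓ hne hpos
    (one_pos.trans_le (one_le_theta hℓ (by omega) hup))
    (add_theta_sub_le hℓ hlow hup (hasLinearSolution_qs hne))

lemma logb_sub_one_le_logb_qs (hα : 2 ≤ α) (hℓ : 1 ≤ ℓ) (hlow : ℓ + ε < h)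
    (hup : h ≤ α * ℓ + ε) (hh : h < 2 * ℓ + ε) (hr : 1 ≤ r) :
    Real.logb 2 ((r : ℝ) / (gam * ((α : ℝ) - 1))) / ((ℓ : ℝ) * (ε + 1)) ≤
      Real.logb 2 (qs α ℓ ε h r) := by
  have hne := scalarSizes_nonempty hα hup hr
  have hα1 : (0 : ℝ) < (α : ℝ) - 1 := by
    have : (2 : ℝ) ≤ α := by exact_mod_cast hα
    linarith
  exact logb_div_le_logb_qs hℓ hne (by positivity) hα1
    (le_sub_one_mul hℓ hlow hup hh (hasLinearSolution_qs hne))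

lemma explicit_bound_of_two_mul_add_le (hα : 2 ≤ α) (hℓ : 1 ≤ ℓ) (hlow : ℓ + ε < h) (hε : 1 ≤ ε)
    (hup : h < α * ℓ + ε) (hr : 1 ≤ r) (hpos : 0 < (r : ℝ) + theta α ℓ ε h - α) :
    Real.logb 2 (((r : ℝ) + theta α ℓ ε h - α) / (gam * theta α ℓ ε h)) / ((ℓ : ℝ) * (ε + 1)) -
        (⌈Real.sqrt (((α : ℝ) - 1) * Real.logb 2 ((r : ℝ) / beta α) /
          (((α : ℝ) * ℓ + ε - h) * ε))⌉₊ : ℝ) ≤ gap α ℓ ε h r := by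
  have hne := scalarSizes_nonempty hα hup.le hr
  have hβ := beta_pos α hα
  have hα1 : (0 : ℝ) < (α : ℝ) - 1 := by
    have : (2 : ℝ) ≤ α := by exact_mod_cast hα
    linarith
  have hZ : (0 : ℝ) < ((α : ℝ) * ℓ + ε - h) * ε := by
    have h1 : (h : ℝ) < α * ℓ + ε := by exact_mod_cast hup
    have h2 : (1 : ℝ) ≤ ε := by exact_mod_cast hε
    exact mul_pos (by linarith) (by linarith)
  set s := ((α : ℝ) - 1) * Real.logb 2 ((r : ℝ) / beta α) / (((α : ℝ) * ℓ + ε - h) * ε) with hs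
  set T := ⌈Real.sqrt s⌉₊ with hT
  have hsT : s ≤ (T : ℝ) ^ 2 := by
    have h1 : Real.sqrt s ≤ T := Nat.le_ceil _
    exact (Real.sqrt_le_left (by positivity)).1 h1
  have hlog : ((α : ℝ) - 1) * Real.logb 2 ((r : ℝ) / beta α) ≤
      ((α : ℝ) * ℓ + ε - h) * ε * (T : ℝ) ^ 2 := by
    rw [hs, div_le_iff₀ hZ] at hsT
    linarith
  rcases Nat.eq_zero_or_pos T with hT0 | hT0
  · -- Here `r ≤ β ≤ α`, so the logarithm of the first term is not positive.
    rw [hT0] at hlog ⊢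
    have h1 : Real.logb 2 ((r : ℝ) / beta α) ≤ 0 := by
      refine nonpos_of_mul_nonpos_right ?_ hα1
      simpa using hlog
    have h2 : (r : ℝ) ≤ α := by
      rw [Real.logb_nonpos_iff one_lt_two (by positivity), div_le_one hβ] at h1
      exact h1.trans (beta_le hα)
    have hθ := one_le_theta hℓ (by omega : ε ≤ h) hup.le
    have h3 : Real.logb 2 (((r : ℝ) + theta α ℓ ε h - α) / (gam * theta α ℓ ε h)) ≤ 0 := by
      have hg : 0 < gam := by norm_num [gam]
      rw [Real.logb_nonpos_iff one_lt_two (by positivity), div_le_one (by positivity), gam]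
      linarith
    have h4 := div_nonpos_of_nonpos_of_nonneg h3 (by positivity : (0 : ℝ) ≤ (ℓ : ℝ) * (ε + 1))
    have := gap_nonneg hne
    push_cast
    linarith
  · refine sub_le_gap hne hT0 (hasLinearSolution_of_le_rpow_f hα hup.le ?_)
      (logb_theta_le_logb_qs hα hℓ hlow hup.le hr hpos)
    rw [← Real.logb_le_iff_le_rpow one_lt_two (by positivity), le_div_iff₀ hα1]
    linarith [mul_sq_le_f (α := α) hup.le T]

lemma explicit_bound_of_lt_two_mul_add (hα : 2 ≤ α) (hℓ : 1 ≤ ℓ) (hlow : ℓ + ε < h) (hε : 1 ≤ ε)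
    (hup : h ≤ α * ℓ + ε) (hh : h < 2 * ℓ + ε) (hr : 1 ≤ r) :
    (Real.logb 2 ((r : ℝ) / ((α : ℝ) - 1)) - 2) / ((ℓ : ℝ) * (ε + 1)) -
        (⌈Real.sqrt (Real.logb 2 ((r : ℝ) / ((α : ℝ) - 1)) / gLead ℓ ε h)⌉₊ : ℝ) ≤
      gap α ℓ ε h r := by
  have hne := scalarSizes_nonempty hα hup hr
  have hα1 : (0 : ℝ) < (α : ℝ) - 1 := by
    have : (2 : ℝ) ≤ α := by exact_mod_cast hα
    linarith
  have hlead := gLead_pos hℓ hε hlow hh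
  have hD : (0 : ℝ) ≤ (ℓ : ℝ) * (ε + 1) := by positivity
  set x := Real.logb 2 ((r : ℝ) / ((α : ℝ) - 1)) with hx
  set T := ⌈Real.sqrt (x / gLead ℓ ε h)⌉₊ with hT
  have hxT : x ≤ gLead ℓ ε h * (T : ℝ) ^ 2 := by
    have h1 : Real.sqrt (x / gLead ℓ ε h) ≤ T := Nat.le_ceil _
    rw [Real.sqrt_le_left (by positivity), div_le_iff₀ hlead] at h1
    linarith
  rcases Nat.eq_zero_or_pos T with hT0 | hT0
  · rw [hT0] at hxT ⊢
    have h1 : x - 2 ≤ 0 := by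
      simp at hxT
      linarith
    have h2 := div_nonpos_of_nonpos_of_nonneg h1 hD
    have := gap_nonneg hne
    push_cast
    linarith
  · refine sub_le_gap hne hT0 (hasLinearSolution_of_le_rpow_g hα hℓ hT0 hlow hh ?_) ?_
    · rw [← Real.logb_le_iff_le_rpow one_lt_two (by positivity)]
      have := le_g hℓ hlow hh T
      have : (0 : ℝ) ≤ T := by positivity
      linarith
    · refine le_trans ?_ (logb_sub_one_le_logb_qs hα hℓ hlow hup hh hr)
      refine div_le_div_of_nonneg_right ?_ hD
      have hg : 0 < gam := by norm_num [gam]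
      have h1 : (r : ℝ) / (gam * ((α : ℝ) - 1)) = r / ((α : ℝ) - 1) / gam := by
        rw [div_div, mul_comm gam]
      rw [h1, Real.logb_div (by positivity) hg.ne']
      have h2 : Real.logb 2 gam ≤ 2 := by
        rw [Real.logb_le_iff_le_rpow one_lt_two hg, gam]
        norm_num
      linarith

end Explicit

/-! ### Asymptotics -/

/-- A square root of a linear function is eventually absorbed by half of the linear term, since
`√y ≤ δ y + 1 / (4 δ)`. -/
lemma eventually_half_mul_le {D E : ℝ} (hD : 0 < D) (hE : 0 < E) (K b : ℝ) :
    ∀ᶠ x : ℝ in Filter.atTop, D / 2 * x ≤ D * x - K - ⌈Real.sqrt (E * (x + b))⌉₊ := by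
  filter_upwards [Filter.eventually_ge_atTop (-b),
    Filter.eventually_ge_atTop (4 / D * (K + D / 4 * b + E / D + 1))] with x hx1 hx2
  set s := Real.sqrt (E * (x + b)) with hs
  have h1 : (⌈s⌉₊ : ℝ) < s + 1 := Nat.ceil_lt_add_one (Real.sqrt_nonneg _)
  have h2 : s ^ 2 = E * (x + b) := Real.sq_sqrt (mul_nonneg hE.le (by linarith))
  have h3 : s ≤ D / (4 * E) * s ^ 2 + E / D := by
    have h4 : D / (4 * E) * s ^ 2 + E / D - s = (D * s - 2 * E) ^ 2 / (4 * E * D) := by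
      field_simp
      ring
    have h5 : 0 ≤ (D * s - 2 * E) ^ 2 / (4 * E * D) := by positivity
    linarith
  have h6 : D / (4 * E) * s ^ 2 = D / 4 * (x + b) := by
    rw [h2]
    field_simp
  have h7 : K + D / 4 * b + E / D + 1 ≤ D / 4 * x := by
    have := mul_le_mul_of_nonneg_left hx2 (by positivity : 0 ≤ D / 4)
    refine le_trans (le_of_eq ?_) this
    field_simp
  linarith

lemma tendsto_logb_natCast :
    Filter.Tendsto (fun r : ℕ => Real.logb 2 (r : ℝ)) Filter.atTop Filter.atTop :=
  (Real.tendsto_logb_atTop one_lt_two).comp tendsto_natCast_atTop_atTop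

lemma eventually_mul_logb_le_gap {α ℓ ε h : ℕ} (hα : 2 ≤ α) (hℓ : 1 ≤ ℓ) (hlow : ℓ + ε < h)
    (hε : 1 ≤ ε) (hup : h < α * ℓ + ε) :
    ∃ c : ℝ, 0 < c ∧ ∀ᶠ r : ℕ in Filter.atTop, c * Real.logb 2 (r : ℝ) ≤ gap α ℓ ε h r := by
  have hα1 : (0 : ℝ) < (α : ℝ) - 1 := by
    have : (2 : ℝ) ≤ α := by exact_mod_cast hα
    linarith
  have hℓ0 : (0 : ℝ) < ℓ := by exact_mod_cast hℓ
  have hD : (0 : ℝ) < 1 / ((ℓ : ℝ) * (ε + 1)) := by positivity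
  refine ⟨1 / ((ℓ : ℝ) * (ε + 1)) / 2, by positivity, ?_⟩
  by_cases hh : 2 * ℓ + ε ≤ h
  · have hβ := beta_pos α hα
    have hZ : (0 : ℝ) < ((α : ℝ) * ℓ + ε - h) * ε := by
      have h1 : (h : ℝ) < α * ℓ + ε := by exact_mod_cast hup
      have h2 : (1 : ℝ) ≤ ε := by exact_mod_cast hε
      exact mul_pos (by linarith) (by linarith)
    have hθ := one_le_theta hℓ (by omega : ε ≤ h) hup.le
    have hg : 0 < gam := by norm_num [gam]
    have hev := tendsto_logb_natCast.eventually (eventually_half_mul_le hD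
      (div_pos hα1 hZ)
      (1 / ((ℓ : ℝ) * (ε + 1)) * Real.logb 2 (2 * (gam * theta α ℓ ε h)))
      (-Real.logb 2 (beta α)))
    filter_upwards [hev, Filter.eventually_ge_atTop (2 * α)] with r h1 hr
    have hr1 : 1 ≤ r := by omega
    have hr0 : (0 : ℝ) < r := by exact_mod_cast hr1
    have hr2 : 2 * (α : ℝ) ≤ r := by exact_mod_cast hr
    refine le_trans ?_ (explicit_bound_of_two_mul_add_le hα hℓ hlow hε hup hr1 (by linarith))
    refine h1.trans (sub_le_sub ?_ (le_of_eq ?_))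
    · rw [← mul_sub, ← Real.logb_div hr0.ne' (by positivity), div_mul_eq_mul_div, one_mul]
      refine div_le_div_of_nonneg_right (Real.logb_le_logb_of_le one_lt_two (by positivity) ?_)
        (by positivity)
      rw [← div_div]
      refine div_le_div_of_nonneg_right ?_ (by positivity)
      linarith
    · rw [← sub_eq_add_neg, ← Real.logb_div hr0.ne' hβ.ne', div_mul_eq_mul_div]
  · have hlead := gLead_pos hℓ hε hlow (not_le.1 hh)
    have hev := tendsto_logb_natCast.eventually (eventually_half_mul_le hD
      (one_div_pos.2 hlead)
      (1 / ((ℓ : ℝ) * (ε + 1)) * (Real.logb 2 ((α : ℝ) - 1) + 2))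
      (-Real.logb 2 ((α : ℝ) - 1)))
    filter_upwards [hev, Filter.eventually_ge_atTop 1] with r h1 hr1
    have hr0 : (0 : ℝ) < r := by exact_mod_cast hr1
    refine le_trans ?_ (explicit_bound_of_lt_two_mul_add hα hℓ hlow hε hup.le (not_le.1 hh) hr1)
    refine h1.trans (sub_le_sub (le_of_eq ?_) (le_of_eq ?_))
    · rw [Real.logb_div hr0.ne' hα1.ne']
      ring
    · rw [← sub_eq_add_neg, ← Real.logb_div hr0.ne' hα1.ne', div_mul_eq_mul_div, one_mul]

lemma gap_isTheta {α ℓ ε h : ℕ} (hα : 2 ≤ α) (hℓ : 1 ≤ ℓ) (hlow : ℓ + ε < h)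
    (hε : 1 ≤ ε) (hup : h < α * ℓ + ε) :
    (fun r : ℕ => gap α ℓ ε h r) =Θ[Filter.atTop] (fun r : ℕ => Real.logb 2 (r : ℝ)) := by
  constructor
  · refine Asymptotics.IsBigO.of_bound (Real.logb 2 (20 * α) + (α - 1)) ?_
    filter_upwards [Filter.eventually_ge_atTop 2] with r hr
    have hr1 : 1 ≤ r := by omega
    have h1 : 1 ≤ Real.logb 2 (r : ℝ) := by
      rw [Real.le_logb_iff_rpow_le one_lt_two (by positivity), Real.rpow_one]
      exact_mod_cast hr
    have h2 : 0 ≤ Real.logb 2 (20 * (α : ℝ)) := by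
      refine Real.logb_nonneg one_lt_two ?_
      have : (2 : ℝ) ≤ α := by exact_mod_cast hα
      linarith
    rw [Real.norm_of_nonneg (gap_nonneg (scalarSizes_nonempty hα hup.le hr1)),
      Real.norm_of_nonneg (by linarith)]
    have h3 := gap_le hα hup.le hr1 (ε := ε)
    nlinarith
  · obtain ⟨c, hc, hev⟩ := eventually_mul_logb_le_gap hα hℓ hlow hε hup
    refine Asymptotics.IsBigO.of_bound c⁻¹ ?_
    filter_upwards [hev, Filter.eventually_ge_atTop 1] with r h1 hr
    rw [Real.norm_of_nonneg (gap_nonneg (scalarSizes_nonempty hα hup.le hr)),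
      Real.norm_of_nonneg (Real.logb_nonneg one_lt_two (by exact_mod_cast hr)),
      le_inv_mul_iff₀ hc]
    exact h1

end GenCombNet

theorem mainTheorem12 (α ℓ ε h : ℕ) (hα : 2 ≤ α) (hℓ : 1 ≤ ℓ)
    (hlow : ℓ + ε < h) (hup : h ≤ α * ℓ + ε) :
    -- the minima that define the gap are taken over nonempty sets
    (∀ r : ℕ, 1 ≤ r →
      (GenCombNet.scalarSizes α ℓ ε h r).Nonempty ∧
      (GenCombNet.vectorSizes α ℓ ε h r).Nonempty) ∧
    -- the lower bound for `h ≥ 2ℓ + ε`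
    (2 * ℓ + ε ≤ h → ∀ r : ℕ, 1 ≤ r →
      ((ε ≠ 0 ∨ h ≠ α * ℓ) → ∃ t : ℕ, GenCombNet.IsTDelta α ℓ ε h r t) ∧
      (0 < (r : ℝ) + GenCombNet.theta α ℓ ε h - α →
        ∀ tΔ : ℕ, GenCombNet.IsTDelta α ℓ ε h r tΔ →
          1 / ((ℓ : ℝ) * (ε + 1)) *
              Real.logb 2 (((r : ℝ) + GenCombNet.theta α ℓ ε h - α) /
                (GenCombNet.gam * GenCombNet.theta α ℓ ε h)) - tΔ
            ≤ GenCombNet.gap α ℓ ε h r)) ∧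
    -- the lower bound for `h < 2ℓ + ε`
    (h < 2 * ℓ + ε → ∀ r : ℕ, 1 ≤ r →
      (∃ t : ℕ, GenCombNet.IsTStar α ℓ ε h r t) ∧
      (∀ tS : ℕ, GenCombNet.IsTStar α ℓ ε h r tS →
        1 / ((ℓ : ℝ) * (ε + 1)) *
            Real.logb 2 ((r : ℝ) / (GenCombNet.gam * ((α : ℝ) - 1))) - tS
          ≤ GenCombNet.gap α ℓ ε h r)) ∧
    -- explicit bounds and asymptotics with direct links
    (1 ≤ ε → h < α * ℓ + ε →
      (2 * ℓ + ε ≤ h → ∀ r : ℕ, 1 ≤ r →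
        0 < (r : ℝ) + GenCombNet.theta α ℓ ε h - α → GenCombNet.beta α ≤ (r : ℝ) →
          Real.logb 2 (((r : ℝ) + GenCombNet.theta α ℓ ε h - α) /
                (GenCombNet.gam * GenCombNet.theta α ℓ ε h)) / ((ℓ : ℝ) * (ε + 1)) -
              (⌈Real.sqrt (((α : ℝ) - 1) * Real.logb 2 ((r : ℝ) / GenCombNet.beta α) /
                (((α : ℝ) * ℓ + ε - h) * ε))⌉₊ : ℝ)
            ≤ GenCombNet.gap α ℓ ε h r) ∧
      (h < 2 * ℓ + ε → ∀ r : ℕ, 1 ≤ r → α - 1 ≤ r →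
          (Real.logb 2 ((r : ℝ) / ((α : ℝ) - 1)) - 2) / ((ℓ : ℝ) * (ε + 1)) -
              (⌈Real.sqrt (Real.logb 2 ((r : ℝ) / ((α : ℝ) - 1)) /
                GenCombNet.gLead ℓ ε h)⌉₊ : ℝ)
            ≤ GenCombNet.gap α ℓ ε h r) ∧
      (∃ c : ℝ, 0 < c ∧ ∀ᶠ r : ℕ in Filter.atTop,
        c * Real.logb 2 (r : ℝ) ≤ GenCombNet.gap α ℓ ε h r) ∧
      (fun r : ℕ => GenCombNet.gap α ℓ ε h r) =Θ[Filter.atTop]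
        (fun r : ℕ => Real.logb 2 (r : ℝ))) := by
  refine ⟨fun r hr => ?_, fun hh r hr => ⟨fun hne => ?_, fun hpos tΔ ht => ?_⟩,
    fun hh r hr => ⟨?_, fun tS ht => ?_⟩, fun hε hup' => ⟨?_, ?_, ?_, ?_⟩⟩
  · have hne := GenCombNet.scalarSizes_nonempty hα hup hr
    exact ⟨hne, hne.mono (GenCombNet.scalarSizes_subset_vectorSizes ..)⟩
  · exact GenCombNet.exists_isTDelta hα hup hne hr
  · rw [one_div_mul_eq_div]
    exact GenCombNet.sub_le_gap (GenCombNet.scalarSizes_nonempty hα hup hr) ht.1.1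
      (GenCombNet.hasLinearSolution_of_le_rpow_f hα hup ht.1.2)
      (GenCombNet.logb_theta_le_logb_qs hα hℓ hlow hup hr hpos)
  · exact GenCombNet.exists_isTStar hα hℓ hlow hh hr
  · rw [one_div_mul_eq_div]
    exact GenCombNet.sub_le_gap (GenCombNet.scalarSizes_nonempty hα hup hr) ht.1.1
      (GenCombNet.hasLinearSolution_of_le_rpow_g hα hℓ ht.1.1 hlow hh ht.1.2)
      (GenCombNet.logb_sub_one_le_logb_qs hα hℓ hlow hup hh hr)
  · exact fun _ r hr hpos _ =>
      GenCombNet.explicit_bound_of_two_mul_add_le hα hℓ hlow hε hup' hr hpos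
  · exact fun hh r hr _ => GenCombNet.explicit_bound_of_lt_two_mul_add hα hℓ hlow hε hup hh hr
  · exact GenCombNet.eventually_mul_logb_le_gap hα hℓ hlow hε hup'
  · exact GenCombNet.gap_isTheta hα hℓ hlow hε hup'
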